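/- A randomized algorithm for $n\times n$ matrices is a probability distribution over deterministic adaptive algorithms (decision trees) whose only access to the unknown real matrix $A$ is through the oracle that, given any $x\in\mathbb{R}^n$, answers whether $\|Ax\|_\infty\le 1$ is true or false; its complexity is the number of oracle queries made in the worst case, over all admissible inputs and (almost surely) over the internal randomness. Call an $n \times n$ matrix $A$ admissible if its entries lie in $[-1,1]$ and its smallest singular value is at least $2^{-12}n^{-7}$. There exist absolute constants $c>0$ and $C>0$ such that for every $n\ge 2$ the following holds: any randomized algorithm which, for every admissible $n\times n$ matrix $A$, outputs a number $V$ such that $$(1-c)\,|\det A|\le V\le (1+c)\,|\det A|$$ holds with probability at least $1-1/n$, has complexity at least $C\,n^2/\log n$. -/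

import Mathlib

open MeasureTheory

noncomputable section

/-- The answer of the oracle for the hidden matrix `A` to the query `x`: is `‖A x‖_∞ ≤ 1`?
(The norm of `Fin n → ℝ` is the maximum norm.) -/
def oracleAnswer {n : ℕ} (A : Matrix (Fin n) (Fin n) ℝ) (x : Fin n → ℝ) : Bool := by
  classical exact decide (‖A.mulVec x‖ ≤ 1)

/-- A deterministic adaptive algorithm (a decision tree): from the list of the answers received so
far (most recent answer first) it either asks the oracle a next query `x` (`Sum.inl x`) or stops
with an output `V` (`Sum.inr V`). -/
abbrev DetAlgorithm (n : ℕ) : Type := List Bool → (Fin n → ℝ) ⊕ ℝ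

/-- Run the algorithm on the hidden matrix `A`, from the list `h` of earlier answers, with at most
`q` further queries; the result is the output, or `none` if a query beyond these `q` is asked. -/
def DetAlgorithm.runFrom {n : ℕ} (a : DetAlgorithm n) (A : Matrix (Fin n) (Fin n) ℝ) :
    ℕ → List Bool → Option ℝ
  | 0, h =>
    match a h with
    | Sum.inl _ => none
    | Sum.inr V => some V
  | q + 1, h =>
    match a h with
    | Sum.inl x => DetAlgorithm.runFrom a A q (oracleAnswer A x :: h)
    | Sum.inr V => some V

/-- On input `A` the algorithm `a` stops with output `V` after at most `q` queries. -/
def DetAlgorithm.OutputsWithin {n : ℕ} (a : DetAlgorithm n) (A : Matrix (Fin n) (Fin n) ℝ)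
    (q : ℕ) (V : ℝ) : Prop :=
  a.runFrom A q [] = some V

/-- On input `A` the algorithm `a` makes at most `q` queries and then stops. -/
def DetAlgorithm.MakesAtMost {n : ℕ} (a : DetAlgorithm n) (A : Matrix (Fin n) (Fin n) ℝ)
    (q : ℕ) : Prop :=
  ∃ V : ℝ, a.OutputsWithin A q V

/-- On input `A` the algorithm `a` stops and its output `V` satisfies
`(1 - c) |det A| ≤ V ≤ (1 + c) |det A|`. -/
def DetAlgorithm.ApproximatesDet {n : ℕ} (a : DetAlgorithm n) (A : Matrix (Fin n) (Fin n) ℝ)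
    (c : ℝ) : Prop :=
  ∃ (q : ℕ) (V : ℝ), a.OutputsWithin A q V ∧ (1 - c) * |A.det| ≤ V ∧ V ≤ (1 + c) * |A.det|

/-- A randomized algorithm with random seed in `Ω`: a measurable family of deterministic
algorithms.  Together with a probability measure on `Ω` it is a probability distribution over
deterministic algorithms. -/
structure RandomizedAlgorithm (n : ℕ) (Ω : Type*) [MeasurableSpace Ω] where
  /-- the deterministic algorithm that is followed with seed `ω` -/
  alg : Ω → DetAlgorithm n
  /-- the next action after given answers depends measurably on the seed -/
  measurable_alg : ∀ h : List Bool, Measurable fun ω => alg ω h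

/-- The smallest singular value of an `n × n` matrix (`1 ≤ n`): Mathlib's singular values are
indexed from `0` in decreasing order. -/
def minSingularValue {n : ℕ} (A : Matrix (Fin n) (Fin n) ℝ) : ℝ :=
  (Matrix.toEuclideanLin A).singularValues (n - 1)

/-- The admissible inputs: matrices with entries in `[-1, 1]` and smallest singular value at least
`2⁻¹² n⁻⁷`. -/
def AdmissibleMatrix {n : ℕ} (A : Matrix (Fin n) (Fin n) ℝ) : Prop :=
  (∀ i j, A i j ∈ Set.Icc (-1 : ℝ) 1) ∧ 1 / (2 ^ 12 * (n : ℝ) ^ 7) ≤ minSingularValue A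

end

/-! The bound is a communication lower bound. Take inputs `1 + signBlock s p` whose two off-diagonal
blocks are sign vectors `x`, `y` of length `N` of order `n ^ 2`, scaled by `s` with `n * s ^ 2 = β`
a small constant. A query asks whether every coordinate of `A x` is at most 1 in absolute value.
Each row involves only one of the two sign vectors, so the answer is a conjunction of a bit of `x`
and a bit of `y` (`oracleAnswer_hardMatrix`). A deterministic run with `q` queries therefore cuts
the pairs into at most `4 ^ q` rectangles with constant output (`exists_rectangle_partition`).

In the Leibniz expansion the transpositions contribute `-s ^ 2 * signInner x y`, which fluctuates on
the scale `β`. Distinct monomials are orthogonal under independent signs, and at most `n ^ t`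
permutations move `t` points, so the terms moving at least 3 points have root mean square of order
`β ^ (3/2)`, negligible for small `β`. The same orthogonality bounds the cofactors, hence the
smallest singular value: most pairs give admissible matrices (`card_not_isTypical_le`). An
approximation of the determinant thus locates `signInner x y` within a small multiple of `n`, that
is, of `√N`.

This is impossible on a large rectangle (`signInner_dispersion`): one side shatters a set `J` of
proportional size, the other contains two vectors that agree off `J` and differ in many places of
`J`. The difference of their inner products with the first side is a Rademacher sum, which is often
of order `√N`. Averaging over the seed (`exists_seed`) reduces randomized algorithms to
deterministic ones. The argument gives a bound of order `n ^ 2`, without the logarithmic loss. -/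

section Cube

open Finset

variable {α : Type*} [DecidableEq α]

/-! ### Rademacher sums -/

/-- The `±1` indicator of a set. -/
def spin (s : Finset α) (a : α) : ℝ := if a ∈ s then 1 else -1

lemma spin_eq_of_mem_iff {s t : Finset α} {a : α} (h : a ∈ s ↔ a ∈ t) : spin s a = spin t a := by
  simp only [spin, h]

/-- Fourth moment bound for Rademacher sums. -/
lemma rademacher_moments (w : α → ℝ) (J : Finset α) :
    (∑ u ∈ J.powerset, (∑ p ∈ J, spin u p * w p) ^ 2 = 2 ^ #J * ∑ p ∈ J, w p ^ 2) ∧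
    (∑ u ∈ J.powerset, (∑ p ∈ J, spin u p * w p) ^ 4 ≤ 2 ^ #J * (3 * (∑ p ∈ J, w p ^ 2) ^ 2)) := by
  induction J using Finset.induction_on with
  | empty => simp
  | insert a J ha ih =>
    obtain ⟨ih2, ih4⟩ := ih
    have e1 : ∀ u ∈ J.powerset, ∑ p ∈ insert a J, spin u p * w p
        = (∑ p ∈ J, spin u p * w p) - w a := by
      intro u hu
      have : a ∉ u := fun h => ha (mem_powerset.1 hu h)
      rw [sum_insert ha]; simp [spin, this]; ring
    have e2 : ∀ u ∈ J.powerset, ∑ p ∈ insert a J, spin (insert a u) p * w p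
        = (∑ p ∈ J, spin u p * w p) + w a := by
      intro u hu
      rw [sum_insert ha, add_comm]
      congr 1
      · refine sum_congr rfl fun p hp => ?_
        have : p ≠ a := fun h => ha (h ▸ hp)
        rw [spin_eq_of_mem_iff (t := u) (by simp [this])]
      · simp [spin]
    set Q := ∑ p ∈ J, w p ^ 2
    have hQ : 0 ≤ Q := sum_nonneg fun _ _ => sq_nonneg _
    have hstep : ∀ k : ℕ, ∑ u ∈ (insert a J).powerset, (∑ p ∈ insert a J, spin u p * w p) ^ k
        = ∑ u ∈ J.powerset, (((∑ p ∈ J, spin u p * w p) - w a) ^ k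
          + ((∑ p ∈ J, spin u p * w p) + w a) ^ k) := by
      intro k
      rw [sum_powerset_insert ha, ← sum_add_distrib]
      exact sum_congr rfl fun u hu => by rw [e1 u hu, e2 u hu]
    constructor
    · rw [hstep, sum_insert ha, card_insert_of_notMem ha,
        sum_congr rfl fun u _ => show ((∑ p ∈ J, spin u p * w p) - w a) ^ 2
          + ((∑ p ∈ J, spin u p * w p) + w a) ^ 2
          = 2 * (∑ p ∈ J, spin u p * w p) ^ 2 + 2 * w a ^ 2 by ring,
        sum_add_distrib, ← mul_sum, ih2, sum_const, card_powerset]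
      simp only [nsmul_eq_mul, Nat.cast_pow, Nat.cast_ofNat]
      ring
    · rw [hstep, sum_insert ha, card_insert_of_notMem ha,
        sum_congr rfl fun u _ => show ((∑ p ∈ J, spin u p * w p) - w a) ^ 4
          + ((∑ p ∈ J, spin u p * w p) + w a) ^ 4
          = 2 * (∑ p ∈ J, spin u p * w p) ^ 4 + 12 * w a ^ 2 * (∑ p ∈ J, spin u p * w p) ^ 2
            + 2 * w a ^ 4 by ring,
        sum_add_distrib, sum_add_distrib, ← mul_sum, ← mul_sum, ih2, sum_const, card_powerset]
      simp only [nsmul_eq_mul, Nat.cast_pow, Nat.cast_ofNat]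
      have h2 : (0 : ℝ) ≤ 2 ^ #J * w a ^ 4 := by positivity
      rw [pow_succ (2 : ℝ)]
      nlinarith

/-- Anticoncentration of Rademacher sums, from the second and fourth moments. -/
lemma card_filter_rademacher_gt (w : α → ℝ) (J : Finset α) {θ : ℝ}
    (hQ : 0 < ∑ p ∈ J, w p ^ 2) (hθ : 2 * θ ^ 2 ≤ ∑ p ∈ J, w p ^ 2) :
    (2 : ℝ) ^ #J ≤ 12 * #{u ∈ J.powerset | θ < |∑ p ∈ J, spin u p * w p|} := by
  obtain ⟨h2, h4⟩ := rademacher_moments w J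
  set S : Finset α → ℝ := fun u => ∑ p ∈ J, spin u p * w p with hS
  set Q := ∑ p ∈ J, w p ^ 2
  set F := {u ∈ J.powerset | θ < |S u|} with hF
  have hsplit := sum_filter_add_sum_filter_not J.powerset (fun u => θ < |S u|) (fun u => S u ^ 2)
  have hsmall : ∑ u ∈ J.powerset with ¬ θ < |S u|, S u ^ 2 ≤ 2 ^ #J * θ ^ 2 := by
    calc ∑ u ∈ J.powerset with ¬ θ < |S u|, S u ^ 2
        ≤ ∑ u ∈ J.powerset with ¬ θ < |S u|, θ ^ 2 := by
          refine sum_le_sum fun u hu => ?_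
          rw [mem_filter] at hu
          exact sq_le_sq' (abs_le.1 (not_lt.1 hu.2)).1 (abs_le.1 (not_lt.1 hu.2)).2
      _ ≤ ∑ u ∈ J.powerset, θ ^ 2 :=
          sum_le_sum_of_subset_of_nonneg (filter_subset _ _) fun _ _ _ => sq_nonneg _
      _ = _ := by simp
  have hlarge : (2 : ℝ) ^ #J * (Q / 2) ≤ ∑ u ∈ F, S u ^ 2 := by
    have : (0:ℝ) < 2 ^ #J := by positivity
    have h2' : ∑ u ∈ J.powerset, S u ^ 2 = 2 ^ #J * Q := h2
    nlinarith
  -- Paley–Zygmund: values at most `θ` carry at most half of the second moment, and Cauchy–Schwarz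
  -- against the fourth moment bounds `#F` below. The constant is `12 = 4 * 3`.
  have hcs : (∑ u ∈ F, S u ^ 2) ^ 2 ≤ #F * ∑ u ∈ F, (S u ^ 2) ^ 2 := sq_sum_le_card_mul_sum_sq
  have h4' : ∑ u ∈ F, (S u ^ 2) ^ 2 ≤ 2 ^ #J * (3 * Q ^ 2) := by
    refine le_trans ?_ h4
    refine le_trans (sum_le_sum_of_subset_of_nonneg (filter_subset _ _)
      fun _ _ _ => sq_nonneg _) (le_of_eq (sum_congr rfl fun u _ => by simp only [hS]; ring))
  have hP : (0:ℝ) < 2 ^ #J := by positivity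
  generalize (2:ℝ) ^ #J = P at *
  have h5 : (P * (Q / 2)) ^ 2 ≤ #F * (P * (3 * Q ^ 2)) :=
    (pow_le_pow_left₀ (by positivity) hlarge 2).trans (hcs.trans (by gcongr))
  have h6 : (P * Q ^ 2) * P ≤ (P * Q ^ 2) * (12 * #F) := by nlinarith
  exact le_of_mul_le_mul_left h6 (by positivity)

/-! ### Binomial tails, shattering and far pairs -/

/-- Chernoff's argument: in the expansion of `(1 + 2) ^ N` each binomial coefficient with `k ≤ d`
has weight at least `2 ^ N / 2 ^ d`. -/
lemma sum_choose_mul_two_pow_le (N d : ℕ) :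
    2 ^ N * ∑ k ∈ range (d + 1), N.choose k ≤ 2 ^ d * 3 ^ N := by
  have h : (3 : ℕ) ^ N = ∑ k ∈ range (N + 1), 2 ^ (N - k) * N.choose k := by
    have := add_pow (1 : ℕ) 2 N
    simpa using this
  have h' : ∑ k ∈ range (d + 1), 2 ^ (N - k) * N.choose k ≤ 3 ^ N := by
    rw [h]
    have : ∀ k ∈ range (d + 1), k ∉ range (d + 1) ∩ range (N + 1) →
        2 ^ (N - k) * N.choose k = 0 := by
      intro k hk hk'
      rw [Nat.choose_eq_zero_of_lt, mul_zero]
      simp at hk hk'; omega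
    rw [← sum_subset (inter_subset_left) this]
    exact sum_le_sum_of_subset inter_subset_right
  calc 2 ^ N * ∑ k ∈ range (d + 1), N.choose k
      = ∑ k ∈ range (d + 1), 2 ^ N * N.choose k := mul_sum _ _ _
    _ ≤ ∑ k ∈ range (d + 1), 2 ^ d * (2 ^ (N - k) * N.choose k) := by
        refine sum_le_sum fun k hk => ?_
        rw [← mul_assoc, ← pow_add]
        refine Nat.mul_le_mul_right _ (Nat.pow_le_pow_right (by norm_num) ?_)
        simp at hk; omega
    _ = 2 ^ d * ∑ k ∈ range (d + 1), 2 ^ (N - k) * N.choose k := (mul_sum _ _ _).symm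
    _ ≤ _ := Nat.mul_le_mul_left _ h'

/-- Entropy estimate with integer arithmetic only: taking eighth powers reduces it to `2 ^ 3 * 3 ^ 8
≤ 4 ^ 8`. -/
lemma two_pow_mul_sum_choose_lt {N d e : ℕ} (h : 8 * (d + e) < 3 * N) :
    2 ^ e * ∑ k ∈ range (d + 1), N.choose k < 2 ^ N := by
  have h1 := sum_choose_mul_two_pow_le N d
  have h2 : 2 ^ (d + e) * 3 ^ N < 4 ^ N := by
    refine lt_of_pow_lt_pow_left₀ 8 (by positivity) ?_
    calc (2 ^ (d + e) * 3 ^ N) ^ 8 = 2 ^ (8 * (d + e)) * (3 ^ 8) ^ N := by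
          rw [mul_pow, ← pow_mul, ← pow_mul, ← pow_mul, mul_comm N, mul_comm 8 (d + e)]
      _ < 2 ^ (3 * N) * (3 ^ 8) ^ N := by
          refine Nat.mul_lt_mul_of_pos_right (Nat.pow_lt_pow_right (by norm_num) h) (by positivity)
      _ = (2 ^ 3 * 3 ^ 8) ^ N := by rw [mul_pow, pow_mul]
      _ ≤ (4 ^ 8) ^ N := Nat.pow_le_pow_left (by norm_num) N
      _ = (4 ^ N) ^ 8 := by rw [← pow_mul, ← pow_mul, mul_comm]
  have h3 : 2 ^ N * (2 ^ e * ∑ k ∈ range (d + 1), N.choose k) < 2 ^ N * 2 ^ N := by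
    calc 2 ^ N * (2 ^ e * ∑ k ∈ range (d + 1), N.choose k)
        = 2 ^ e * (2 ^ N * ∑ k ∈ range (d + 1), N.choose k) := by ring
      _ ≤ 2 ^ e * (2 ^ d * 3 ^ N) := Nat.mul_le_mul_left _ h1
      _ = 2 ^ (d + e) * 3 ^ N := by ring
      _ < 4 ^ N := h2
      _ = 2 ^ N * 2 ^ N := by rw [← mul_pow]; norm_num
  exact lt_of_mul_lt_mul_left h3 (by positivity)

/-- A large family of subsets of the cube shatters a large set. -/
lemma exists_shatters_of_card [Fintype α] {e : ℕ} (𝒜 : Finset (Finset α))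
    (h𝒜 : 2 ^ Fintype.card α ≤ 2 ^ e * #𝒜) (he : 4 * e < Fintype.card α) :
    ∃ J : Finset α, 𝒜.Shatters J ∧ Fintype.card α < 8 * #J := by
  set N := Fintype.card α
  have hpos : 𝒜.Nonempty := by
    rw [nonempty_iff_ne_empty]; rintro rfl
    simp at h𝒜
  obtain ⟨J, hJ, hJc⟩ : ∃ J ∈ 𝒜.shatterer, #J = 𝒜.vcDim := by
    obtain ⟨J, hJ, h⟩ := exists_mem_eq_sup 𝒜.shatterer
      ⟨∅, mem_shatterer.2 (shatters_empty.2 hpos)⟩ card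
    exact ⟨J, hJ, h.symm⟩
  refine ⟨J, mem_shatterer.1 hJ, ?_⟩
  by_contra hlt
  -- Sauer–Shelah: a family shatters at least as many sets as it has members, and there are too few
  -- sets of size at most `N / 8`.
  have h1 := (card_le_card_shatterer 𝒜).trans card_shatterer_le_sum_vcDim
  rw [← hJc] at h1
  have h2 : ∑ k ∈ Iic #J, N.choose k = ∑ k ∈ range (#J + 1), N.choose k := by
    congr 1; ext; simp
  rw [h2] at h1
  have h3 := two_pow_mul_sum_choose_lt (N := N) (d := #J) (e := e) (by omega)
  have := Nat.mul_le_mul_left (2 ^ e) h1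
  omega

/-- A large family of subsets of a finite set contains two members that are far apart. -/
lemma exists_far_pair {e : ℕ} (J : Finset α) (ℱ : Finset (Finset α))
    (hℱ : 2 ^ #J ≤ 2 ^ e * #ℱ) (hJ : ∀ s ∈ ℱ, ∀ t ∈ ℱ, symmDiff s t ⊆ J) (he : 4 * e < #J) :
    ∃ s ∈ ℱ, ∃ t ∈ ℱ, #J < 8 * #(symmDiff s t) := by
  obtain ⟨t, ht⟩ : ℱ.Nonempty := by
    rw [nonempty_iff_ne_empty]; rintro rfl
    simp at hℱ
  by_contra! hcon
  set d := #J / 8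
  have hcard : #ℱ ≤ ∑ k ∈ range (d + 1), (#J).choose k := by
    have : #ℱ ≤ #((range (d + 1)).biUnion fun k => powersetCard k J) := by
      -- Translation by a fixed member `t` embeds the family into a Hamming ball around `∅` inside
      -- `J`.
      refine card_le_card_of_injOn (fun s => symmDiff s t) ?_
        (fun a _ b _ hab => symmDiff_left_injective t hab)
      intro s hs
      have := hcon s hs t ht
      simp only [coe_biUnion, Set.mem_iUnion, mem_coe, mem_range, mem_powersetCard, exists_prop]
      exact ⟨_, by omega, hJ s hs t ht, rfl⟩
    refine this.trans (card_biUnion_le.trans (le_of_eq ?_))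
    simp
  have h3 := two_pow_mul_sum_choose_lt (N := #J) (d := d) (e := e) (by omega)
  have := Nat.mul_le_mul_left (2 ^ e) hcard
  omega

/-- Markov's inequality in natural numbers. Exceeding `b` means reaching `b + 1`, a positive factor
that can be cancelled even when `b = 0`. -/
lemma card_le_two_mul_card_filter {ι : Type*} (S : Finset ι) (f : ι → ℕ) {a b : ℕ}
    (h : 2 * a * ∑ s ∈ S, f s ≤ #S * b) : #S ≤ 2 * #{s ∈ S | a * f s ≤ b} := by
  have h1 := card_filter_add_card_filter_not (s := S) (fun s => a * f s ≤ b)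
  have h2 : #{s ∈ S | ¬ a * f s ≤ b} * (b + 1) ≤ a * ∑ s ∈ S, f s := by
    rw [mul_sum]
    calc #{s ∈ S | ¬ a * f s ≤ b} * (b + 1) = ∑ s ∈ S with ¬ a * f s ≤ b, (b + 1) := by simp
      _ ≤ ∑ s ∈ S with ¬ a * f s ≤ b, a * f s := by
        refine sum_le_sum fun s hs => ?_
        rw [mem_filter] at hs; omega
      _ ≤ _ := sum_le_sum_of_subset (filter_subset _ _)
  have h3 : (2 * #{s ∈ S | ¬ a * f s ≤ b}) * (b + 1) ≤ #S * (b + 1) := by nlinarith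
  have h4 := Nat.le_of_mul_le_mul_right h3 (Nat.succ_pos b)
  omega

/-! ### Dispersion of inner products on large rectangles -/

/-- The inner product of two sign vectors. -/
def signInner [Fintype α] (x y : Finset α) : ℝ := ∑ p, spin x p * spin y p

/-- On a large combinatorial rectangle, the inner product of two sign vectors is not concentrated
in a window that is short compared to the square root of the dimension. -/
theorem signInner_dispersion [Fintype α] {e : ℕ} {𝒳 𝒴 : Finset (Finset α)}
    (h𝒳 : 2 ^ Fintype.card α ≤ 2 ^ e * #𝒳) (h𝒴 : 2 ^ Fintype.card α ≤ 2 ^ e * #𝒴)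
    (he : 32 * (e + 2) ≤ Fintype.card α) (B : Finset (Finset α × Finset α))
    (hB : 100 * #{p ∈ 𝒳 ×ˢ 𝒴 | p ∈ B} ≤ #𝒳 * #𝒴) {V W : ℝ}
    (hW : 128 * W ^ 2 ≤ Fintype.card α) :
    ∃ x ∈ 𝒳, ∃ y ∈ 𝒴, (x, y) ∉ B ∧ W < |signInner x y - V| := by
  by_contra! hgood
  set N := Fintype.card α
  have hBsum : #{p ∈ 𝒳 ×ˢ 𝒴 | p ∈ B} = ∑ x ∈ 𝒳, #{y ∈ 𝒴 | (x, y) ∈ B} := by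
    simp only [card_filter, sum_product]
  -- Two uses of Markov double the density of exceptions, 1/100 to 1/50 to 1/25, and halve each
  -- side, which costs one unit of `e`. The rows must be cleaned before `J` is chosen, so that every
  -- chosen representative is good.
  set 𝒳' := {x ∈ 𝒳 | 50 * #{y ∈ 𝒴 | (x, y) ∈ B} ≤ #𝒴} with h𝒳'
  have h𝒳'c : #𝒳 ≤ 2 * #𝒳' := card_le_two_mul_card_filter 𝒳 _ (by rw [hBsum] at hB; omega)
  obtain ⟨J, hJ, hJc⟩ := exists_shatters_of_card (e := e + 1) 𝒳'
    (h𝒳.trans (by rw [pow_succ, mul_assoc]; exact Nat.mul_le_mul_left _ h𝒳'c)) (by omega)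
  -- Each sign pattern `u` on `J` gets one representative in the family. Its entries off `J` are
  -- uncontrolled, hence the need for `y`, `y'` that agree there.
  choose! ξ hξ𝒳 hξJ using fun (u : Finset α) (hu : u ⊆ J) => hJ hu
  have hξ : ∀ u ∈ J.powerset, 50 * #{y ∈ 𝒴 | (ξ u, y) ∈ B} ≤ #𝒴 := fun u hu =>
    (mem_filter.1 (hξ𝒳 u (mem_powerset.1 hu))).2
  set 𝒴' := {y ∈ 𝒴 | 25 * #{u ∈ J.powerset | (ξ u, y) ∈ B} ≤ 2 ^ #J} with h𝒴'
  have h𝒴'c : #𝒴 ≤ 2 * #𝒴' := by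
    refine card_le_two_mul_card_filter 𝒴 _ ?_
    have h1 : ∑ y ∈ 𝒴, #{u ∈ J.powerset | (ξ u, y) ∈ B}
        = ∑ u ∈ J.powerset, #{y ∈ 𝒴 | (ξ u, y) ∈ B} := by
      simp only [card_filter]; exact sum_comm
    rw [h1, mul_sum]
    calc ∑ u ∈ J.powerset, 2 * 25 * #{y ∈ 𝒴 | (ξ u, y) ∈ B} ≤ ∑ u ∈ J.powerset, #𝒴 :=
          sum_le_sum hξ
      _ = #𝒴 * 2 ^ #J := by simp [mul_comm]
  -- Pigeonhole over the traces outside `J`: some fibre is as dense in the cube on `J` as `𝒴'` is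
  -- known to be in the full cube.
  obtain ⟨r, hr⟩ : ∃ r, 2 ^ #J ≤ 2 ^ (e + 1) * #{y ∈ 𝒴' | y \ J = r} := by
    by_contra! hcon
    have h1 : #𝒴' = ∑ r ∈ (univ \ J).powerset, #{y ∈ 𝒴' | y \ J = r} :=
      card_eq_sum_card_fiberwise fun y _ => by
        simp only [mem_coe, mem_powerset]; exact sdiff_subset_sdiff (subset_univ _) le_rfl
    have h2 : 2 ^ (e + 1) * #𝒴' < 2 ^ N := by
      rw [h1, mul_sum]
      calc ∑ r ∈ (univ \ J).powerset, 2 ^ (e + 1) * #{y ∈ 𝒴' | y \ J = r}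
          < ∑ r ∈ (univ \ J).powerset, 2 ^ #J :=
            sum_lt_sum_of_nonempty ⟨∅, by simp⟩ fun r _ => hcon r
        _ = 2 ^ N := by
            rw [sum_const, card_powerset, smul_eq_mul, ← pow_add, card_sdiff_of_subset
              (subset_univ _), card_univ, Nat.sub_add_cancel (card_le_univ J)]
    have h3 : 2 ^ N ≤ 2 ^ (e + 1) * #𝒴' :=
      h𝒴.trans (by rw [pow_succ, mul_assoc]; exact Nat.mul_le_mul_left _ h𝒴'c)
    omega
  obtain ⟨y, hy, y', hy', hfar⟩ := exists_far_pair J _ hr (by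
    intro s hs t ht a ha
    rw [mem_filter] at hs ht
    by_contra haJ
    have h1 : a ∈ s ↔ a ∈ t := by
      have := hs.2.trans ht.2.symm
      have h2 : a ∈ s \ J ↔ a ∈ t \ J := by rw [this]
      simpa [haJ] using h2
    rw [mem_symmDiff] at ha
    tauto) (by omega)
  rw [mem_filter] at hy hy'
  have hyJ : ∀ p ∉ J, spin y p = spin y' p := by
    intro p hp
    refine spin_eq_of_mem_iff ?_
    have h2 : p ∈ y \ J ↔ p ∈ y' \ J := by rw [hy.2, hy'.2]
    simpa [hp] using h2
  set w : α → ℝ := fun p => spin y p - spin y' p with hw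
  have hQ : (N : ℝ) / 16 ≤ ∑ p ∈ J, w p ^ 2 := by
    have h1 : ∀ p ∈ symmDiff y y', w p ^ 2 = 4 := by
      intro p hp
      rw [mem_symmDiff] at hp
      rcases hp with ⟨h1, h2⟩ | ⟨h1, h2⟩ <;> simp [hw, spin, h1, h2] <;> norm_num
    have h2 : symmDiff y y' ⊆ J := by
      intro p hp
      by_contra hpJ
      have := h1 p hp
      simp [hw, hyJ p hpJ] at this
    calc (N : ℝ) / 16 ≤ #(symmDiff y y') * 4 := by
          have : (N : ℝ) ≤ 64 * #(symmDiff y y') := by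
            exact_mod_cast (show N ≤ 64 * #(symmDiff y y') by omega)
          linarith
      _ = ∑ p ∈ symmDiff y y', w p ^ 2 := by rw [sum_congr rfl h1]; simp
      _ ≤ _ := sum_le_sum_of_subset_of_nonneg h2 fun _ _ _ => sq_nonneg _
  have hNpos : (0 : ℝ) < N := by
    have : 0 < N := by omega
    exact_mod_cast this
  have hanti := card_filter_rademacher_gt w J (θ := 2 * W) (by linarith) (by nlinarith)
  -- If neither pair is exceptional, both inner products lie within `W` of `V` and differ by at most
  -- `2 * W`. So a large Rademacher sum forces an exception.
  have hsub : {u ∈ J.powerset | 2 * W < |∑ p ∈ J, spin u p * w p|}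
      ⊆ {u ∈ J.powerset | (ξ u, y) ∈ B} ∪ {u ∈ J.powerset | (ξ u, y') ∈ B} := by
    intro u hu
    rw [mem_filter] at hu
    by_contra hcon
    simp only [mem_union, mem_filter, hu.1, true_and, not_or] at hcon
    have hx := (mem_filter.1 (hξ𝒳 u (mem_powerset.1 hu.1))).1
    have g1 := hgood _ hx _ (mem_filter.1 hy.1).1 hcon.1
    have g2 := hgood _ hx _ (mem_filter.1 hy'.1).1 hcon.2
    have h1 : signInner (ξ u) y - signInner (ξ u) y' = ∑ p ∈ J, spin u p * w p := by
      rw [signInner, signInner, ← sum_sub_distrib]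
      have : ∀ p ∈ (univ : Finset α), p ∉ J →
          spin (ξ u) p * spin y p - spin (ξ u) p * spin y' p = 0 := by
        intro p _ hp; rw [hyJ p hp, sub_self]
      rw [← sum_subset (subset_univ J) this]
      refine sum_congr rfl fun p hp => ?_
      have hm : p ∈ u ↔ p ∈ ξ u := by
        conv_lhs => rw [← hξJ u (mem_powerset.1 hu.1)]
        simp [hp]
      rw [spin_eq_of_mem_iff hm, hw]; ring
    rw [← h1] at hu
    have := abs_sub_le (signInner (ξ u) y) V (signInner (ξ u) y')
    rw [abs_sub_comm V] at this
    linarith [hu.2]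
  have hc := (card_le_card hsub).trans (card_union_le _ _)
  have b1 := (mem_filter.1 hy.1).2
  have b2 := (mem_filter.1 hy'.1).2
  -- The contradiction is `1/25 + 1/25 < 1/12`.
  have hanti' : 2 ^ #J ≤ 12 * #{u ∈ J.powerset | 2 * W < |∑ p ∈ J, spin u p * w p|} := by
    exact_mod_cast hanti
  have : 0 < 2 ^ #J := by positivity
  omega

end Cube

/-! ### Second moments of Leibniz expansions with random signs -/

section RandomDeterminant

open Finset Equiv

variable {ι Ω : Type*} [DecidableEq ι]

/-- The monomial of `σ` in the Leibniz expansion, restricted to the columns in `E`. -/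
def permMonomial (M : Matrix ι ι ℝ) (E : Finset ι) (σ : Perm ι) : ℝ := ∏ i ∈ E, M (σ i) i

/-- A finite uniform family of matrices with zero diagonal and entries bounded by `s` that is
symmetric under changing the sign of any single entry. -/
structure IsSignSymmetric (N : Ω → Matrix ι ι ℝ) (s : ℝ) : Prop where
  diag : ∀ ω i, N ω i i = 0
  bound : ∀ ω i j, |N ω i j| ≤ s
  flip : ∀ i j, ∃ φ : Perm Ω, ∀ ω, N (φ ω) i j = -N ω i j ∧
    ∀ k l, (k, l) ≠ (i, j) → N (φ ω) k l = N ω k l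

namespace IsSignSymmetric

variable {N : Ω → Matrix ι ι ℝ} {s : ℝ}

/-- Flipping the sign of the off-diagonal entry `(σ i, i)` negates the monomial of `σ` and fixes
that of `τ`, which uses another entry of column `i`. The sum equals its own negative. -/
lemma sum_permMonomial_mul_of_moved [Fintype Ω] (hN : IsSignSymmetric N s) {E : Finset ι} {σ τ : Perm ι}
    {i : ι} (hi : i ∈ E) (hστ : σ i ≠ τ i) (hσ : σ i ≠ i) :
    ∑ ω, permMonomial (1 + N ω) E σ * permMonomial (1 + N ω) E τ = 0 := by
  obtain ⟨φ, hφ⟩ := hN.flip (σ i) i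
  have h1 : ∀ ω, permMonomial (1 + N (φ ω)) E σ = -permMonomial (1 + N ω) E σ := by
    intro ω
    rw [permMonomial, permMonomial, ← mul_prod_erase E _ hi, ← mul_prod_erase E _ hi,
      ← neg_mul]
    congr 1
    · simp [Matrix.one_apply_ne hσ, (hφ ω).1]
    · refine prod_congr rfl fun k hk => ?_
      rw [Matrix.add_apply, Matrix.add_apply, (hφ ω).2]
      intro h
      exact (mem_erase.1 hk).1 (Prod.ext_iff.1 h).2
  have h2 : ∀ ω, permMonomial (1 + N (φ ω)) E τ = permMonomial (1 + N ω) E τ := by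
    intro ω
    refine prod_congr rfl fun k hk => ?_
    rw [Matrix.add_apply, Matrix.add_apply, (hφ ω).2]
    intro h
    obtain ⟨ha, hb⟩ := Prod.ext_iff.1 h
    simp only at ha hb
    subst hb
    exact hστ ha.symm
  have h3 := Equiv.sum_comp φ
    (fun ω => permMonomial (1 + N ω) E σ * permMonomial (1 + N ω) E τ)
  simp only [h1, h2, neg_mul, sum_neg_distrib] at h3
  linarith

lemma sum_permMonomial_mul [Fintype Ω] (hN : IsSignSymmetric N s) {E : Finset ι} {σ τ : Perm ι}
    {i : ι} (hi : i ∈ E) (hστ : σ i ≠ τ i) :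
    ∑ ω, permMonomial (1 + N ω) E σ * permMonomial (1 + N ω) E τ = 0 := by
  by_cases hσ : σ i = i
  · simp only [mul_comm (permMonomial _ E σ)]
    exact hN.sum_permMonomial_mul_of_moved hi hστ.symm (by rw [← hσ]; exact fun h => hστ (by
      rw [hσ] at h; rw [h, hσ]))
  · exact hN.sum_permMonomial_mul_of_moved hi hστ hσ

lemma sq_permMonomial_le (hN : IsSignSymmetric N s) (E : Finset ι) (σ : Perm ι) (ω : Ω) :
    permMonomial (1 + N ω) E σ ^ 2 ≤ (s ^ 2) ^ #{i ∈ E | σ i ≠ i} := by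
  rw [permMonomial, ← prod_pow, ← prod_const, prod_filter]
  refine prod_le_prod (fun _ _ => sq_nonneg _) fun i _ => ?_
  split_ifs with h
  · rw [Matrix.add_apply, Matrix.one_apply_ne h, zero_add]
    have := hN.bound ω (σ i) i
    exact sq_le_sq' (abs_le.1 this).1 (abs_le.1 this).2
  · push Not at h
    rw [h, Matrix.add_apply, hN.diag]; simp

end IsSignSymmetric

variable [Fintype ι]

/-- The number of permutations of a finite set that move exactly `t` points. -/
lemma card_perm_support_eq_le (t : ℕ) :
    #{σ : Perm ι | #σ.support = t} ≤ Fintype.card ι ^ t := by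
  have h1 : ∀ S : Finset ι, #{σ : Perm ι | σ.support = S} ≤ (#S).factorial := by
    intro S
    have h2 : Fintype.card {σ : Perm ι // ∀ a, a ∉ S → σ a = a} = (#S).factorial := by
      rw [← Fintype.card_congr (Perm.subtypeEquivSubtypePerm (· ∈ S)), Fintype.card_perm]
      simp
    rw [← h2, Fintype.card_subtype]
    refine card_le_card fun σ hσ => ?_
    simp only [mem_filter, mem_univ, true_and] at hσ ⊢
    intro a ha
    rw [← hσ] at ha
    exact Perm.notMem_support.1 ha
  have h3 : #{σ : Perm ι | #σ.support = t}
      ≤ ∑ S ∈ powersetCard t univ, #{σ : Perm ι | σ.support = S} := by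
    refine le_trans (card_le_card fun σ hσ => ?_) card_biUnion_le
    simp only [mem_filter, mem_univ, true_and, mem_biUnion, mem_powersetCard] at hσ ⊢
    exact ⟨_, ⟨subset_univ _, hσ⟩, rfl⟩
  calc #{σ : Perm ι | #σ.support = t} ≤ ∑ S ∈ powersetCard t (univ : Finset ι), t.factorial :=
        h3.trans (sum_le_sum fun S hS => by
          rw [← (mem_powersetCard.1 hS).2]; exact h1 S)
    _ = (Fintype.card ι).descFactorial t := by
        rw [sum_const, card_powersetCard, smul_eq_mul, card_univ, mul_comm,
          Nat.descFactorial_eq_factorial_mul_choose]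
    _ ≤ _ := Nat.descFactorial_le_pow _ _

lemma sum_geometric_tail_le {β : ℝ} (h0 : 0 ≤ β) (h1 : β ≤ 1 / 2) (a b : ℕ) :
    ∑ t ∈ Ico a b, β ^ t ≤ 2 * β ^ a := by
  have h := geom_sum_Ico_le_of_lt_one (m := a) (n := b) h0 (by linarith)
  refine h.trans ?_
  rw [div_le_iff₀ (by linarith)]
  nlinarith [pow_nonneg h0 a]

/-- Groups permutations by the number of moved points. The predicate `P` allows the same estimate
for the transpositions, for the tail, and for all permutations. -/
lemma sum_perm_support_le (f : ℕ → ℝ) (hf : ∀ t, 0 ≤ f t) (P : ℕ → Prop) [DecidablePred P] :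
    ∑ σ : Perm ι with P #σ.support, f #σ.support
      ≤ ∑ t ∈ range (Fintype.card ι + 1) with P t, (Fintype.card ι : ℝ) ^ t * f t := by
  have hmaps : ∀ σ ∈ ({σ : Perm ι | P #σ.support} : Finset (Perm ι)),
      #σ.support ∈ ({t ∈ range (Fintype.card ι + 1) | P t} : Finset ℕ) := by
    intro σ hσ
    simp only [mem_filter, mem_univ, true_and, mem_range] at hσ ⊢
    exact ⟨Nat.lt_succ_of_le (card_le_univ _), hσ⟩
  rw [← sum_fiberwise_of_maps_to hmaps]
  refine sum_le_sum fun t _ => ?_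
  calc ∑ σ ∈ {σ ∈ ({σ : Perm ι | P #σ.support} : Finset (Perm ι)) | #σ.support = t},
        f #σ.support
      = #{σ ∈ ({σ : Perm ι | P #σ.support} : Finset (Perm ι)) | #σ.support = t} * f t := by
        rw [sum_congr rfl fun σ hσ => by rw [(mem_filter.1 hσ).2]]; simp
    _ ≤ (Fintype.card ι : ℝ) ^ t * f t := by
        refine mul_le_mul_of_nonneg_right ?_ (hf t)
        refine le_trans ?_ (show ((Fintype.card ι ^ t : ℕ) : ℝ) ≤ _ by push_cast; rfl)
        refine Nat.cast_le.2 (le_trans (card_le_card ?_) (card_perm_support_eq_le t))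
        exact filter_subset_filter _ (subset_univ _)

/-- Serves the cofactors, where one moved column may be missing from the monomial. The lost factor
`v` costs a factor of the dimension; the vacuous condition only matches the shape of
`sum_perm_support_le`. -/
lemma sum_pow_support_sub_one_le {v : ℝ} (hv : 0 ≤ v) (h : Fintype.card ι * v ≤ 1 / 2) :
    ∑ σ : Perm ι with 0 ≤ #σ.support, v ^ (#σ.support - 1) ≤ 1 + 2 * Fintype.card ι := by
  refine (sum_perm_support_le (fun t => v ^ (t - 1)) (fun t => by positivity) (0 ≤ ·)).trans ?_
  have h1 : ({t ∈ range (Fintype.card ι + 1) | 0 ≤ t} : Finset ℕ)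
      = range (Fintype.card ι + 1) := filter_true_of_mem fun _ _ => Nat.zero_le _
  rw [h1, sum_range_succ']
  have h2 : ∀ t ∈ range (Fintype.card ι),
      (Fintype.card ι : ℝ) ^ (t + 1) * v ^ (t + 1 - 1)
        = Fintype.card ι * (Fintype.card ι * v) ^ t := by
    intro t _
    rw [Nat.add_sub_cancel, mul_pow, pow_succ]; ring
  rw [sum_congr rfl h2, ← mul_sum, range_eq_Ico]
  have h3 := sum_geometric_tail_le (mul_nonneg (Nat.cast_nonneg _) hv) h 0 (Fintype.card ι)
  have h4 := mul_le_mul_of_nonneg_left h3 (Nat.cast_nonneg (α := ℝ) (Fintype.card ι))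
  simp only [pow_zero, mul_one, Nat.zero_sub] at h4 ⊢
  linarith

/-- Writes a cofactor in monomials that omit column `i`, so that the orthogonality of monomials
applies to it as well. -/
lemma adjugate_eq_sum (M : Matrix ι ι ℝ) (i j : ι) :
    M.adjugate i j = ∑ σ : Perm ι with σ i = j,
      (Perm.sign σ : ℝ) * permMonomial M (univ.erase i) σ := by
  rw [Matrix.adjugate_apply, Matrix.det_apply', sum_filter]
  refine sum_congr rfl fun σ _ => ?_
  rw [← mul_prod_erase univ _ (mem_univ i)]
  split_ifs with h
  · have : ∀ k ∈ univ.erase i, M.updateRow j (Pi.single i 1) (σ k) k = M (σ k) k := by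
      intro k hk
      rw [Matrix.updateRow_ne]
      rw [← h]
      exact fun h' => (mem_erase.1 hk).1 (σ.injective h')
    rw [prod_congr rfl this, h, Matrix.updateRow_self, Pi.single_eq_same, one_mul, permMonomial]
  · have hk : σ⁻¹ j ∈ univ.erase i := by
      rw [mem_erase]
      refine ⟨fun h' => h ?_, mem_univ _⟩
      rw [← h']; simp
    rw [prod_eq_zero hk]
    · simp
    · have hne : σ⁻¹ j ≠ i := (mem_erase.1 hk).1
      rw [show σ (σ⁻¹ j) = j by simp, Matrix.updateRow_self, Pi.single_eq_of_ne hne]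

namespace IsSignSymmetric

variable {N : Ω → Matrix ι ι ℝ} {s : ℝ}

/-- Second moment of a signed sum of monomials of the Leibniz expansion. -/
lemma sum_sq_le [Fintype Ω] (hN : IsSignSymmetric N s) {E : Finset ι} {S : Finset (Perm ι)}
    (hS : ∀ σ ∈ S, ∀ τ ∈ S, σ ≠ τ → ∃ i ∈ E, σ i ≠ τ i) :
    ∑ ω, (∑ σ ∈ S, (Perm.sign σ : ℝ) * permMonomial (1 + N ω) E σ) ^ 2
      ≤ Fintype.card Ω * ∑ σ ∈ S, (s ^ 2) ^ #{i ∈ E | σ i ≠ i} := by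
  have h1 : ∀ ω, (∑ σ ∈ S, (Perm.sign σ : ℝ) * permMonomial (1 + N ω) E σ) ^ 2
      = ∑ σ ∈ S, ∑ τ ∈ S, ((Perm.sign σ : ℝ) * (Perm.sign τ : ℝ)) *
        (permMonomial (1 + N ω) E σ * permMonomial (1 + N ω) E τ) := by
    intro ω
    rw [sq, sum_mul_sum]
    exact sum_congr rfl fun σ _ => sum_congr rfl fun τ _ => by ring
  simp only [h1]
  rw [sum_comm, mul_sum]
  refine sum_le_sum fun σ hσ => ?_
  rw [sum_comm, sum_eq_single σ]
  · have hs : ((Perm.sign σ : ℤ) : ℝ) * ((Perm.sign σ : ℤ) : ℝ) = 1 := by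
      rcases Int.units_eq_one_or (Perm.sign σ) with h | h <;> simp [h]
    calc _ ≤ ∑ ω : Ω, (s ^ 2) ^ #{i ∈ E | σ i ≠ i} := by
          refine sum_le_sum fun ω _ => ?_
          rw [hs, one_mul, ← sq]
          exact hN.sq_permMonomial_le E σ ω
      _ = _ := by simp
  · intro τ hτ hne
    obtain ⟨i, hi, h⟩ := hS σ hσ τ hτ hne.symm
    rw [← mul_sum, hN.sum_permMonomial_mul hi h, mul_zero]
  · exact fun h => absurd hσ h

/-- The part of the Leibniz expansion of `det (1 + N)` in which at least `k` points are moved has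
small second moment. -/
lemma sum_sq_tail_le [Fintype Ω] (hN : IsSignSymmetric N s) (P : ℕ → Prop) [DecidablePred P] {k : ℕ}
    (hP : ∀ t, P t → k ≤ t) (hs : Fintype.card ι * s ^ 2 ≤ 1 / 2) :
    ∑ ω, (∑ σ : Perm ι with P #σ.support,
        (Perm.sign σ : ℝ) * permMonomial (1 + N ω) univ σ) ^ 2
      ≤ Fintype.card Ω * (2 * (Fintype.card ι * s ^ 2) ^ k) := by
  refine (hN.sum_sq_le ?_).trans (mul_le_mul_of_nonneg_left ?_ (Nat.cast_nonneg _))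
  · intro σ _ τ _ hne
    obtain ⟨i, hi⟩ := DFunLike.ne_iff.1 hne
    exact ⟨i, mem_univ _, hi⟩
  · refine (sum_perm_support_le (fun t => (s ^ 2) ^ t) (fun t => by positivity) P).trans ?_
    refine le_trans ?_ (sum_geometric_tail_le (by positivity) hs k (Fintype.card ι + 1))
    simp only [← mul_pow]
    refine sum_le_sum_of_subset_of_nonneg (fun t ht => ?_) fun _ _ _ => by positivity
    simp only [mem_filter, mem_range, mem_Ico] at ht ⊢
    exact ⟨hP t ht.2, ht.1⟩

/-- Second moment of a cofactor. -/
lemma sum_sq_adjugate_le [Fintype Ω] (hN : IsSignSymmetric N s) (hs : Fintype.card ι * s ^ 2 ≤ 1 / 2)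
    (hs1 : s ^ 2 ≤ 1) (i j : ι) :
    ∑ ω, (1 + N ω).adjugate i j ^ 2 ≤ Fintype.card Ω * (1 + 2 * Fintype.card ι) := by
  simp only [adjugate_eq_sum]
  refine (hN.sum_sq_le ?_).trans (mul_le_mul_of_nonneg_left ?_ (Nat.cast_nonneg _))
  · intro σ hσ τ hτ hne
    obtain ⟨k, hk⟩ := DFunLike.ne_iff.1 hne
    refine ⟨k, mem_erase.2 ⟨?_, mem_univ _⟩, hk⟩
    rintro rfl
    simp only [mem_filter, mem_univ, true_and] at hσ hτ
    exact hk (hσ.trans hτ.symm)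
  refine le_trans (sum_le_sum fun σ _ => ?_) (le_trans (sum_le_sum_of_subset_of_nonneg
    (fun σ _ => by simp) fun _ _ _ => by positivity)
    (sum_pow_support_sub_one_le (sq_nonneg s) hs))
  refine pow_le_pow_of_le_one (sq_nonneg s) hs1 ?_
  rw [filter_erase]
  exact pred_card_le_card_erase

end IsSignSymmetric

/-- Chebyshev's inequality for a finite uniform family. -/
lemma card_filter_lt_abs_mul_sq_le [Fintype Ω] (f : Ω → ℝ) {τ : ℝ} (hτ : 0 ≤ τ) :
    #{ω | τ < |f ω|} * τ ^ 2 ≤ ∑ ω, f ω ^ 2 := by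
  calc #{ω | τ < |f ω|} * τ ^ 2 = ∑ ω with τ < |f ω|, τ ^ 2 := by simp
    _ ≤ ∑ ω with τ < |f ω|, f ω ^ 2 := by
        refine sum_le_sum fun ω hω => ?_
        rw [← sq_abs (f ω)]
        exact pow_le_pow_left₀ hτ (mem_filter.1 hω).2.le 2
    _ ≤ _ := sum_le_sum_of_subset_of_nonneg (subset_univ _) fun _ _ _ => sq_nonneg _

end RandomDeterminant

/-! ### Smallest singular value from cofactors -/

section SmallestSingularValue

open Module

/-- A bound on the cofactors and a lower bound on the determinant bound the smallest singular
value from below. -/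
lemma le_minSingularValue {n : ℕ} (hn : 0 < n) (A : Matrix (Fin n) (Fin n) ℝ) {K : ℝ} (hK : 0 < K)
    (hdet : 1 / 2 ≤ |A.det|) (hadj : ∑ i, ∑ j, A.adjugate i j ^ 2 ≤ K ^ 2) :
    1 / (2 * K) ≤ minSingularValue A := by
  set T := Matrix.toEuclideanLin A with hT
  set μ := T.singularValues (n - 1) with hμ
  have hμ0 : 0 ≤ μ := T.singularValues_nonneg _
  have hlt : n - 1 < finrank ℝ (EuclideanSpace ℝ (Fin n)) := by
    rw [finrank_euclideanSpace_fin]; omega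
  obtain ⟨v, hv⟩ := (T.hasEigenvalue_adjoint_comp_self_sq_singularValues hlt).exists_hasEigenvector
  have hv1 : LinearMap.adjoint T (T v) = μ ^ 2 • v := by
    simpa using hv.apply_eq_smul
  have hv0 : 0 < ‖v‖ ^ 2 := by
    have := norm_pos_iff.2 hv.2
    positivity
  have h1 : ‖T v‖ ^ 2 = μ ^ 2 * ‖v‖ ^ 2 := by
    rw [← real_inner_self_eq_norm_sq, ← LinearMap.adjoint_inner_left, hv1, real_inner_smul_left,
      real_inner_self_eq_norm_sq]
  -- Cramer's rule bounds `|det A| * ‖v‖` by the Frobenius norm of the adjugate times `‖A v‖`, and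
  -- `‖A v‖ = μ * ‖v‖` for this eigenvector.
  have h2 : ∀ i, A.det * v i = ∑ j, A.adjugate i j * T v j := by
    intro i
    have h3 : A.adjugate.mulVec (A.mulVec v.ofLp) = A.det • v.ofLp := by
      rw [Matrix.mulVec_mulVec, Matrix.adjugate_mul, Matrix.smul_mulVec, Matrix.one_mulVec]
    have := congrFun h3 i
    simp only [Pi.smul_apply, smul_eq_mul] at this
    rw [← this]
    rfl
  have h4 : A.det ^ 2 * ‖v‖ ^ 2 ≤ K ^ 2 * ‖T v‖ ^ 2 := by
    rw [EuclideanSpace.real_norm_sq_eq, EuclideanSpace.real_norm_sq_eq, Finset.mul_sum]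
    calc ∑ i, A.det ^ 2 * v i ^ 2 = ∑ i, (∑ j, A.adjugate i j * T v j) ^ 2 :=
          Finset.sum_congr rfl fun i _ => by rw [← h2, mul_pow]
      _ ≤ ∑ i, (∑ j, A.adjugate i j ^ 2) * ∑ j, T v j ^ 2 :=
          Finset.sum_le_sum fun i _ => Finset.sum_mul_sq_le_sq_mul_sq _ _ _
      _ = (∑ i, ∑ j, A.adjugate i j ^ 2) * ∑ j, T v j ^ 2 := by rw [Finset.sum_mul]
      _ ≤ _ := mul_le_mul_of_nonneg_right hadj (Finset.sum_nonneg fun _ _ => sq_nonneg _)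
  have h5 : (1 / 2) ^ 2 ≤ A.det ^ 2 := by
    rw [← sq_abs A.det]; exact pow_le_pow_left₀ (by norm_num) hdet 2
  have h6 : (1 / 2) ^ 2 ≤ (K * μ) ^ 2 := by
    rw [h1] at h4
    refine h5.trans (le_of_mul_le_mul_right ?_ hv0)
    rw [mul_pow]; linarith
  have h7 : 1 / 2 ≤ K * μ := le_of_sq_le_sq h6 (by positivity)
  show 1 / (2 * K) ≤ μ
  rw [div_le_iff₀ (by positivity)]
  linarith

end SmallestSingularValue

/-! ### The random block matrices and their determinants -/

section HardInstances

open Finset Equiv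

variable {I J : Type*} [DecidableEq I] [DecidableEq J]

/-- The matrix with zero diagonal blocks whose off-diagonal blocks hold two sign vectors, scaled
by `s`. -/
def signBlock (s : ℝ) (p : Finset (I × J) × Finset (I × J)) : Matrix (I ⊕ J) (I ⊕ J) ℝ :=
  Matrix.fromBlocks 0 (Matrix.of fun i j => s * spin p.1 (i, j))
    (Matrix.of fun j i => s * spin p.2 (i, j)) 0

lemma abs_spin {α : Type*} [DecidableEq α] (x : Finset α) (a : α) : |spin x a| = 1 := by
  unfold spin; split_ifs <;> simp

lemma spin_symmDiff_singleton {α : Type*} [DecidableEq α] (x : Finset α) (a b : α) :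
    spin (symmDiff x {a}) b = if b = a then -spin x b else spin x b := by
  by_cases hb : b ∈ x <;> by_cases hab : b = a <;> simp [spin, mem_symmDiff, hb, hab]
  all_goals subst hab; simp [hb]

lemma isSignSymmetric_signBlock {s : ℝ} (hs : 0 ≤ s) :
    IsSignSymmetric (signBlock s : Finset (I × J) × Finset (I × J) → _) s where
  diag := by rintro ω (i | i) <;> simp [signBlock]
  bound := by
    rintro ω (i | i) (j | j) <;> simp [signBlock, hs, abs_mul, abs_spin, abs_of_nonneg]
  flip := by
    have hinv : ∀ a : I × J, Function.Involutive fun x : Finset (I × J) => symmDiff x {a} :=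
      fun a x => symmDiff_symmDiff_cancel_right _ _
    rintro (i | i) (j | j)
    · exact ⟨Equiv.refl _, fun ω => by simp [signBlock]⟩
    · refine ⟨Equiv.prodCongr (hinv (i, j)).toPerm (Equiv.refl _), fun ω => ⟨?_, ?_⟩⟩
      · simp [signBlock, spin_symmDiff_singleton]
      · rintro (k | k) (l | l) h <;> simp [signBlock, spin_symmDiff_singleton] at h ⊢
        intro h1 h2; exact absurd h2 (h h1)
    · refine ⟨Equiv.prodCongr (Equiv.refl _) (hinv (j, i)).toPerm, fun ω => ⟨?_, ?_⟩⟩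
      · simp [signBlock, spin_symmDiff_singleton]
      · rintro (k | k) (l | l) h <;> simp [signBlock, spin_symmDiff_singleton] at h ⊢
        intro h1 h2; exact absurd h1 (h h2)
    · exact ⟨Equiv.refl _, fun ω => by simp [signBlock]⟩

variable [Fintype I] [Fintype J]

lemma permMonomial_swap {ι : Type*} [Fintype ι] [DecidableEq ι] (M : Matrix ι ι ℝ)
    (hM : ∀ i, M i i = 1) {a b : ι} (hab : a ≠ b) :
    permMonomial M univ (swap a b) = M b a * M a b := by
  rw [permMonomial, Fintype.prod_eq_mul a b hab]
  · simp
  · rintro x ⟨h1, h2⟩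
    rw [swap_apply_of_ne_of_ne h1 h2, hM]

/-- The contribution of the transpositions to the determinant. -/
lemma sum_transpositions_signBlock (s : ℝ) (p : Finset (I × J) × Finset (I × J)) :
    ∑ σ : Perm (I ⊕ J) with #σ.support = 2,
      (Perm.sign σ : ℝ) * permMonomial (1 + signBlock s p) univ σ
      = -(s ^ 2 * signInner p.1 p.2) := by
  set M := 1 + signBlock s p with hM
  have hdiag : ∀ i, M i i = 1 := by rintro (i | i) <;> simp [hM, signBlock]
  set g : I × J → Perm (I ⊕ J) := fun a => swap (Sum.inl a.1) (Sum.inr a.2) with hg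
  have hginj : Function.Injective g := by
    rintro ⟨i, j⟩ ⟨k, l⟩ h
    have h1 := congrArg (fun σ : Perm (I ⊕ J) => σ (Sum.inl i)) h
    simp only [hg, swap_apply_left] at h1
    by_cases hik : i = k
    · subst hik
      rw [swap_apply_left] at h1
      simpa using h1
    · rw [swap_apply_of_ne_of_ne (by simpa using hik) (by simp)] at h1
      cases h1
  have hsub : univ.image g ⊆ ({σ : Perm (I ⊕ J) | #σ.support = 2} : Finset _) := by
    intro σ hσ
    obtain ⟨a, -, rfl⟩ := mem_image.1 hσ
    simp only [mem_filter, mem_univ, true_and]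
    exact Perm.card_support_swap (by simp)
  rw [← sum_subset hsub, sum_image hginj.injOn, signInner, mul_sum, ← sum_neg_distrib]
  · refine sum_congr rfl fun a _ => ?_
    rw [permMonomial_swap M hdiag (by simp), Perm.sign_swap (by simp)]
    simp [hM, signBlock]; ring
  · intro σ hσ hnot
    simp only [mem_filter, mem_univ, true_and] at hσ
    obtain ⟨a, b, hab, rfl⟩ := Perm.card_support_eq_two.1 hσ
    rw [permMonomial_swap M hdiag hab]
    have hoff : ∀ c d : I, c ≠ d → M (Sum.inl c) (Sum.inl d) = 0 := by
      intro c d h; simp [hM, signBlock, h]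
    have hoff' : ∀ c d : J, c ≠ d → M (Sum.inr c) (Sum.inr d) = 0 := by
      intro c d h; simp [hM, signBlock, h]
    rcases a with a | a <;> rcases b with b | b
    · rw [hoff a b (by simpa using hab)]; simp
    · exact absurd (mem_image.2 ⟨(a, b), mem_univ _, rfl⟩) hnot
    · exact absurd (mem_image.2 ⟨(b, a), mem_univ _, by simp [hg, swap_comm]⟩) hnot
    · rw [hoff' a b (by simpa using hab)]; simp

/-- The part of the determinant of `1 + signBlock s p` beyond its quadratic part. -/
def detRemainder (s : ℝ) (p : Finset (I × J) × Finset (I × J)) : ℝ :=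
  ∑ σ : Perm (I ⊕ J) with 3 ≤ #σ.support,
    (Perm.sign σ : ℝ) * permMonomial (1 + signBlock s p) univ σ

lemma det_one_add_signBlock (s : ℝ) (p : Finset (I × J) × Finset (I × J)) :
    (1 + signBlock s p).det = 1 - s ^ 2 * signInner p.1 p.2 + detRemainder s p := by
  set M := 1 + signBlock s p with hM
  have hdiag : ∀ i, M i i = 1 := by rintro (i | i) <;> simp [hM, signBlock]
  have h0 : ∑ σ : Perm (I ⊕ J) with #σ.support = 0,
      (Perm.sign σ : ℝ) * permMonomial M univ σ = 1 := by
    have : ({σ : Perm (I ⊕ J) | #σ.support = 0} : Finset _) = {1} := by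
      ext σ; simp
    rw [this]
    simp [permMonomial, hdiag]
  rw [Matrix.det_apply']
  change ∑ σ : Perm (I ⊕ J), (Perm.sign σ : ℝ) * permMonomial M univ σ = _
  rw [← sum_filter_add_sum_filter_not univ (fun σ : Perm (I ⊕ J) => 3 ≤ #σ.support),
    ← sum_filter_add_sum_filter_not ({σ : Perm (I ⊕ J) | ¬ 3 ≤ #σ.support} : Finset _)
      (fun σ : Perm (I ⊕ J) => #σ.support = 2), filter_filter, filter_filter]
  have e1 : ({σ : Perm (I ⊕ J) | ¬ 3 ≤ #σ.support ∧ #σ.support = 2} : Finset _)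
      = ({σ : Perm (I ⊕ J) | #σ.support = 2} : Finset _) := by
    refine filter_congr fun σ _ => ?_; omega
  -- No permutation moves exactly one point.
  have e2 : ({σ : Perm (I ⊕ J) | ¬ 3 ≤ #σ.support ∧ ¬ #σ.support = 2} : Finset _)
      = ({σ : Perm (I ⊕ J) | #σ.support = 0} : Finset _) := by
    refine filter_congr fun σ _ => ?_
    have := Perm.card_support_ne_one σ
    omega
  rw [e1, e2, h0, hM, sum_transpositions_signBlock, detRemainder]
  ring

/-- A pair of sign vectors whose matrix has a determinant close to its quadratic part, and small
cofactors. -/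
def IsTypical (s τ : ℝ) (p : Finset (I × J) × Finset (I × J)) : Prop :=
  |s ^ 2 * signInner p.1 p.2| ≤ 1 / 4 ∧ |detRemainder s p| ≤ τ ∧
    ∑ i, ∑ j, (1 + signBlock s p).adjugate i j ^ 2 ≤ ((Fintype.card (I ⊕ J) : ℝ) ^ 2) ^ 2

-- Chebyshev for each of the three conditions. The cofactor sum has mean at most `3 * n ^ 3`,
-- against the threshold `n ^ 4`.
open Classical in
lemma card_not_isTypical_le {s β τ : ℝ} (hs : 0 ≤ s) (hβ : Fintype.card (I ⊕ J) * s ^ 2 = β)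
    (hβ1 : β ≤ 1 / 2) (hτ : 0 < τ) (hn : 0 < Fintype.card (I ⊕ J)) :
    (#{p : Finset (I × J) × Finset (I × J) | ¬ IsTypical s τ p} : ℝ)
      ≤ Fintype.card (Finset (I × J) × Finset (I × J)) *
        (32 * β ^ 2 + 2 * β ^ 3 / τ ^ 2 + 3 / Fintype.card (I ⊕ J)) := by
  have hN := isSignSymmetric_signBlock (I := I) (J := J) hs
  set Ω := Finset (I × J) × Finset (I × J)
  set n := Fintype.card (I ⊕ J) with hnn
  have hn1 : (1 : ℝ) ≤ n := by exact_mod_cast hn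
  have hs1 : s ^ 2 ≤ 1 := by nlinarith [sq_nonneg s]
  have hA : (#{p : Ω | 1 / 4 < |s ^ 2 * signInner p.1 p.2|} : ℝ)
      ≤ Fintype.card Ω * (32 * β ^ 2) := by
    have h1 := card_filter_lt_abs_mul_sq_le (fun p : Ω => s ^ 2 * signInner p.1 p.2)
      (τ := 1 / 4) (by norm_num)
    have h2 := hN.sum_sq_tail_le (· = 2) (k := 2) (fun t ht => ht.ge) (by rw [hβ]; exact hβ1)
    simp only [sum_transpositions_signBlock, neg_sq] at h2
    rw [hβ] at h2
    have := h1.trans h2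
    linarith
  have hB : (#{p : Ω | τ < |detRemainder s p|} : ℝ)
      ≤ Fintype.card Ω * (2 * β ^ 3 / τ ^ 2) := by
    have h1 := card_filter_lt_abs_mul_sq_le (fun p : Ω => detRemainder s p) hτ.le
    have h2 := hN.sum_sq_tail_le (3 ≤ ·) (k := 3) (fun t ht => ht) (by rw [hβ]; exact hβ1)
    rw [hβ] at h2
    have := h1.trans h2
    rw [← mul_div_assoc, le_div_iff₀ (by positivity)]
    exact this
  have hC : (#{p : Ω | (n : ℝ) ^ 2
        < |√(∑ i, ∑ j, (1 + signBlock s p).adjugate i j ^ 2)|} : ℝ)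
      ≤ Fintype.card Ω * (3 / n) := by
    have h1 := card_filter_lt_abs_mul_sq_le
      (fun p : Ω => √(∑ i, ∑ j, (1 + signBlock s p).adjugate i j ^ 2))
      (τ := (n : ℝ) ^ 2) (by positivity)
    have h2 : ∑ p : Ω, √(∑ i, ∑ j, (1 + signBlock s p).adjugate i j ^ 2) ^ 2
        ≤ n * (n * (Fintype.card Ω * (1 + 2 * n))) := by
      have h3 : ∀ p : Ω, √(∑ i, ∑ j, (1 + signBlock s p).adjugate i j ^ 2) ^ 2
          = ∑ i, ∑ j, (1 + signBlock s p).adjugate i j ^ 2 := fun p =>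
        Real.sq_sqrt (sum_nonneg fun _ _ => sum_nonneg fun _ _ => sq_nonneg _)
      rw [sum_congr rfl fun p _ => h3 p, sum_comm]
      calc ∑ i, ∑ p : Ω, ∑ j, (1 + signBlock s p).adjugate i j ^ 2
          ≤ ∑ i : I ⊕ J, ∑ j : I ⊕ J, (Fintype.card Ω * (1 + 2 * n) : ℝ) := by
            refine sum_le_sum fun i _ => ?_
            rw [sum_comm]
            exact sum_le_sum fun j _ => hN.sum_sq_adjugate_le (by rw [hβ]; exact hβ1) hs1 i j
        _ = _ := by simp only [sum_const, card_univ, nsmul_eq_mul, ← hnn]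
    have h4 := h1.trans h2
    rw [← mul_div_assoc, le_div_iff₀ (by positivity)]
    have h5 : (Fintype.card Ω : ℝ) * (1 + 2 * n) ≤ Fintype.card Ω * (3 * n) := by
      gcongr; linarith
    have hnp : (0 : ℝ) < n ^ 3 := by positivity
    refine le_of_mul_le_mul_right ?_ hnp
    have h6 := mul_le_mul_of_nonneg_left h5 (show (0 : ℝ) ≤ n ^ 2 by positivity)
    nlinarith
  have hsub : ({p : Ω | ¬ IsTypical s τ p} : Finset Ω)
      ⊆ (({p : Ω | 1 / 4 < |s ^ 2 * signInner p.1 p.2|} : Finset Ω) ∪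
          ({p : Ω | τ < |detRemainder s p|} : Finset Ω)) ∪
        ({p : Ω | (n : ℝ) ^ 2
          < |√(∑ i, ∑ j, (1 + signBlock s p).adjugate i j ^ 2)|} : Finset Ω) := by
    intro p hp
    by_contra hcon
    simp only [mem_union, mem_filter, mem_univ, true_and, not_or, not_lt] at hp hcon
    refine hp ⟨hcon.1.1, hcon.1.2, ?_⟩
    have h3 := hcon.2
    rw [abs_of_nonneg (Real.sqrt_nonneg _)] at h3
    exact (Real.sqrt_le_left (by positivity)).1 h3
  have h1 := (card_le_card hsub).trans ((card_union_le _ _).trans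
    (Nat.add_le_add_right (card_union_le _ _) _))
  have h2 : (#{p : Ω | ¬ IsTypical s τ p} : ℝ)
      ≤ #{p : Ω | 1 / 4 < |s ^ 2 * signInner p.1 p.2|} + #{p : Ω | τ < |detRemainder s p|} +
        #{p : Ω | (n : ℝ) ^ 2 < |√(∑ i, ∑ j, (1 + signBlock s p).adjugate i j ^ 2)|} := by
    exact_mod_cast h1
  linarith

end HardInstances

/-! ### Decision trees as communication protocols -/

namespace DetAlgorithm

variable {n : ℕ} {a : DetAlgorithm n} {A : Matrix (Fin n) (Fin n) ℝ}

lemma runFrom_zero (h : List Bool) :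
    a.runFrom A 0 h = match a h with
      | Sum.inl _ => none
      | Sum.inr V => some V := by
  rw [DetAlgorithm.runFrom]

lemma runFrom_succ (q : ℕ) (h : List Bool) :
    a.runFrom A (q + 1) h = match a h with
      | Sum.inl x => a.runFrom A q (oracleAnswer A x :: h)
      | Sum.inr V => some V := by
  rw [DetAlgorithm.runFrom]

lemma runFrom_succ_of_eq_some {q : ℕ} {h : List Bool} {V : ℝ}
    (hV : a.runFrom A q h = some V) : a.runFrom A (q + 1) h = some V := by
  induction q generalizing h with
  | zero =>
    rw [runFrom_zero] at hV
    rw [runFrom_succ]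
    cases hah : a h with
    | inl x => simp [hah] at hV
    | inr W => simpa [hah] using hV
  | succ q ih =>
    rw [runFrom_succ] at hV ⊢
    cases hah : a h with
    | inl x =>
      simp only [hah] at hV ⊢
      exact ih hV
    | inr W => simpa [hah] using hV

lemma OutputsWithin.mono {q q' : ℕ} {V : ℝ} (hV : a.OutputsWithin A q V) (hq : q ≤ q') :
    a.OutputsWithin A q' V := by
  induction q', hq using Nat.le_induction with
  | base => exact hV
  | succ k _ ih => exact runFrom_succ_of_eq_some ih

lemma OutputsWithin.unique {q q' : ℕ} {V V' : ℝ} (hV : a.OutputsWithin A q V)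
    (hV' : a.OutputsWithin A q' V') : V = V' := by
  have h1 := hV.mono (le_max_left q q')
  have h2 := hV'.mono (le_max_right q q')
  exact Option.some_inj.1 (h1.symm.trans h2)

lemma ApproximatesDet.exists_outputsWithin {q : ℕ} {c : ℝ} (h : a.ApproximatesDet A c)
    (hq : a.MakesAtMost A q) :
    ∃ V, a.OutputsWithin A q V ∧ (1 - c) * |A.det| ≤ V ∧ V ≤ (1 + c) * |A.det| := by
  obtain ⟨q', V, hV, h1, h2⟩ := h
  obtain ⟨V', hV'⟩ := hq
  obtain rfl := hV.unique hV'
  exact ⟨V, hV', h1, h2⟩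

/-- If every oracle answer is the conjunction of a bit that depends on the first half of the input
and a bit that depends on the second half, then the runs with at most `q` queries split the inputs
into at most `4 ^ q` combinatorial rectangles on which the result is constant. -/
lemma exists_rectangle_partition {X Y : Type*} (M : X → Y → Matrix (Fin n) (Fin n) ℝ)
    (f : X → (Fin n → ℝ) → Bool) (g : Y → (Fin n → ℝ) → Bool)
    (hfg : ∀ x y z, oracleAnswer (M x y) z = (f x z && g y z)) (a : DetAlgorithm n) (q : ℕ)
    (h : List Bool) :
    ∃ leaf : X → Y → Fin (4 ^ q),
      (∀ x y x' y', leaf x y = leaf x' y' → leaf x y' = leaf x y) ∧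
      ∀ x y x' y', leaf x y = leaf x' y' →
        a.runFrom (M x y) q h = a.runFrom (M x' y') q h := by
  induction q generalizing h with
  | zero => exact ⟨fun _ _ => 0, by simp, fun x y x' y' _ => by rw [runFrom_zero, runFrom_zero]⟩
  | succ q ih =>
    cases hah : a h with
    | inr V =>
      refine ⟨fun _ _ => ⟨0, by positivity⟩, by simp, fun x y x' y' _ => ?_⟩
      rw [runFrom_succ, runFrom_succ, hah]
    | inl z =>
      choose leaf h1 h2 using fun b : Bool => ih (b :: h)
      have e : (Bool × Bool) × Fin (4 ^ q) ≃ Fin (4 ^ (q + 1)) :=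
        Fintype.equivFinOfCardEq (by simp [pow_succ]; ring)
      -- The label records both bits, though the algorithm sees only their conjunction. This makes
      -- the fibres rectangles and costs a factor 4 per query.
      refine ⟨fun x y => e ((f x z, g y z), leaf (f x z && g y z) x y), ?_, ?_⟩
      · intro x y x' y' hxy
        simp only [EmbeddingLike.apply_eq_iff_eq, Prod.mk.injEq] at hxy ⊢
        obtain ⟨⟨hf, hg⟩, hl⟩ := hxy
        rw [← hf, ← hg] at hl
        rw [← hg]
        exact ⟨by simp, h1 _ x y x' y' hl⟩
      · intro x y x' y' hxy
        simp only [EmbeddingLike.apply_eq_iff_eq, Prod.mk.injEq] at hxy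
        obtain ⟨⟨hf, hg⟩, hl⟩ := hxy
        rw [← hf, ← hg] at hl
        rw [runFrom_succ, runFrom_succ, hah]
        simp only [hfg]
        rw [← hf, ← hg]
        exact h2 _ x y x' y' hl

end DetAlgorithm

/-! ### Measurability and averaging over the seed -/

namespace RandomizedAlgorithm

variable {n : ℕ} {Ω : Type*} [MeasurableSpace Ω] (R : RandomizedAlgorithm n Ω)
  (A : Matrix (Fin n) (Fin n) ℝ)

lemma measurableSet_oracleAnswer (b : Bool) : MeasurableSet {x | oracleAnswer A x = b} := by
  have h : MeasurableSet {x : Fin n → ℝ | ‖A.mulVec x‖ ≤ 1} :=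
    (isClosed_le (by fun_prop) continuous_const).measurableSet
  cases b with
  | true => simpa [oracleAnswer] using h
  | false => simpa [oracleAnswer, Set.compl_ofPred] using h.compl

lemma measurableSet_runFrom {S : Set ℝ} (hS : MeasurableSet S) (q : ℕ) (h : List Bool) :
    MeasurableSet {ω | ∃ V ∈ S, (R.alg ω).runFrom A q h = some V} := by
  have hhalt : ∀ h, MeasurableSet {ω | R.alg ω h ∈ Sum.inr '' S} := fun h =>
    R.measurable_alg h (hS.inr_image)
  induction q generalizing h with
  | zero =>
    convert hhalt h using 1
    ext ω
    simp only [Set.mem_ofPred_eq, DetAlgorithm.runFrom_zero]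
    cases R.alg ω h <;> simp
  | succ q ih =>
    have : {ω | ∃ V ∈ S, (R.alg ω).runFrom A (q + 1) h = some V}
        = {ω | R.alg ω h ∈ Sum.inr '' S} ∪ ⋃ b : Bool,
          ({ω | R.alg ω h ∈ Sum.inl '' {x | oracleAnswer A x = b}} ∩
            {ω | ∃ V ∈ S, (R.alg ω).runFrom A q (b :: h) = some V}) := by
      ext ω
      simp only [Set.mem_ofPred_eq, DetAlgorithm.runFrom_succ, Set.mem_union, Set.mem_iUnion,
        Set.mem_inter_iff]
      cases R.alg ω h <;> simp
    rw [this]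
    exact (hhalt h).union (MeasurableSet.iUnion fun b =>
      (R.measurable_alg h ((measurableSet_oracleAnswer A b).inl_image)).inter (ih _))

lemma measurableSet_approximatesDet (c : ℝ) :
    MeasurableSet {ω | (R.alg ω).ApproximatesDet A c} := by
  have : {ω | (R.alg ω).ApproximatesDet A c} = ⋃ q : ℕ,
      {ω | ∃ V ∈ Set.Icc ((1 - c) * |A.det|) ((1 + c) * |A.det|),
        (R.alg ω).runFrom A q [] = some V} := by
    ext ω
    simp only [DetAlgorithm.ApproximatesDet, DetAlgorithm.OutputsWithin, Set.mem_ofPred_eq,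
      Set.mem_iUnion, Set.mem_Icc]
    constructor
    · rintro ⟨q, V, h, h1, h2⟩; exact ⟨q, V, ⟨h1, h2⟩, h⟩
    · rintro ⟨q, V, ⟨h1, h2⟩, h⟩; exact ⟨q, V, h, h1, h2⟩
  rw [this]
  exact MeasurableSet.iUnion fun q => R.measurableSet_runFrom A measurableSet_Icc q []

open Classical in
/-- The averaging principle: for every finite family of admissible inputs, some seed gives a
deterministic algorithm that errs on at most a `δ`-fraction of the family. -/
lemma exists_seed {ι : Type*} [Fintype ι] (μ : Measure Ω) [IsProbabilityMeasure μ]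
    (M : ι → Matrix (Fin n) (Fin n) ℝ) {c δ : ℝ} {q : ℕ}
    (hM : ∀ p, 1 - δ ≤ μ.real {ω | (R.alg ω).ApproximatesDet (M p) c})
    (hq : ∀ p, ∀ᵐ ω ∂μ, (R.alg ω).MakesAtMost (M p) q) :
    ∃ ω, (∀ p, (R.alg ω).MakesAtMost (M p) q) ∧
      (Finset.card {p | ¬ (R.alg ω).ApproximatesDet (M p) c} : ℝ) ≤ Fintype.card ι * δ := by
  set F : ι → Set Ω := fun p => {ω | (R.alg ω).ApproximatesDet (M p) c}ᶜ with hF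
  have hFm : ∀ p, MeasurableSet (F p) := fun p => (R.measurableSet_approximatesDet (M p) c).compl
  have hFμ : ∀ p, μ.real (F p) ≤ δ := by
    intro p
    rw [hF, probReal_compl_eq_one_sub (R.measurableSet_approximatesDet (M p) c)]
    linarith [hM p]
  set N : Set Ω := {ω | ¬ ∀ p, (R.alg ω).MakesAtMost (M p) q}
  have hN : μ N = 0 := ae_iff.1 (ae_all_iff.2 hq)
  have hint : ∀ p ∈ (Finset.univ : Finset ι),
      Integrable ((F p).indicator (fun _ => (1 : ℝ))) μ := fun p _ =>
    (integrable_const 1).indicator (hFm p)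
  -- The family is finite, so the seeds exceeding the query bound on some member form a null set; a
  -- seed outside it has at most the mean number of errors.
  obtain ⟨ω, hω, hle⟩ := exists_notMem_null_le_integral
    (integrable_finsetSum Finset.univ hint) hN
  refine ⟨ω, by simpa [N] using hω, ?_⟩
  rw [integral_finsetSum _ hint] at hle
  have h1 : ∑ p, (F p).indicator (fun _ => (1 : ℝ)) ω
      = Finset.card {p | ¬ (R.alg ω).ApproximatesDet (M p) c} := by
    rw [Finset.card_filter, Nat.cast_sum]
    refine Finset.sum_congr rfl fun p _ => ?_
    by_cases h : (R.alg ω).ApproximatesDet (M p) c <;> simp [hF, h]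
  rw [h1] at hle
  refine hle.trans ?_
  calc ∑ p, ∫ ω, (F p).indicator (fun _ => (1 : ℝ)) ω ∂μ ≤ ∑ p : ι, δ := by
        refine Finset.sum_le_sum fun p _ => ?_
        rw [integral_indicator_const _ (hFm p)]
        simpa using hFμ p
    _ = _ := by simp

end RandomizedAlgorithm

/-! ### The lower bound on the number of queries -/

section LowerBound

open Finset

lemma admissibleMatrix_of_det {n : ℕ} (hn : 2 ≤ n) (A : Matrix (Fin n) (Fin n) ℝ)
    (hA : ∀ i j, |A i j| ≤ 1) (hdet : 1 / 2 ≤ |A.det|)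
    (hadj : ∑ i, ∑ j, A.adjugate i j ^ 2 ≤ ((n : ℝ) ^ 2) ^ 2) : AdmissibleMatrix A := by
  have hn1 : (1 : ℝ) ≤ n := by exact_mod_cast (by omega : 1 ≤ n)
  refine ⟨fun i j => abs_le.1 (hA i j), le_trans ?_
    (le_minSingularValue (by omega) A (K := (n : ℝ) ^ 2) (by positivity) hdet hadj)⟩
  refine one_div_le_one_div_of_le (by positivity) ?_
  have : (n : ℝ) ^ 2 ≤ n ^ 7 := pow_le_pow_right₀ hn1 (by norm_num)
  nlinarith [show (0 : ℝ) ≤ n ^ 7 by positivity]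

/-- Among the rectangles of a partition into `K` rectangles, some rectangle is large and contains
few points of a given small set. -/
lemma exists_good_rectangle {X Y : Type*} [Fintype X] [Fintype Y] [DecidableEq X] [DecidableEq Y]
    {K : ℕ} (hK : 0 < K) (leaf : X → Y → Fin K)
    (hleaf : ∀ x y x' y', leaf x y = leaf x' y' → leaf x y' = leaf x y) (B : Finset (X × Y))
    (hB : 200 * #B ≤ Fintype.card X * Fintype.card Y) :
    ∃ (ℓ : Fin K) (𝒳 : Finset X) (𝒴 : Finset Y), (∀ x ∈ 𝒳, ∀ y ∈ 𝒴, leaf x y = ℓ) ∧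
      100 * #{p ∈ 𝒳 ×ˢ 𝒴 | p ∈ B} ≤ #𝒳 * #𝒴 ∧
      Fintype.card X * Fintype.card Y ≤ 2 * K * (#𝒳 * #𝒴) := by
  set T := Fintype.card X * Fintype.card Y with hT
  set F : Fin K → Finset (X × Y) := fun ℓ => {p | leaf p.1 p.2 = ℓ} with hF
  have hFsum : ∑ ℓ, #(F ℓ) = T := by
    rw [hT, ← Fintype.card_prod, ← card_univ]
    exact (card_eq_sum_card_fiberwise fun p _ => mem_univ _).symm
  have hBsum : ∑ ℓ, #{p ∈ F ℓ | p ∈ B} = #B := by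
    rw [card_eq_sum_card_fiberwise (f := fun p : X × Y => leaf p.1 p.2) (t := univ)
      fun p _ => mem_univ _]
    refine sum_congr rfl fun ℓ _ => congrArg _ ?_
    ext p; simp [hF, and_comm]
  -- A single averaged inequality yields both conclusions for the same leaf: size at least `T / (2 *
  -- K)` and exceptional density at most 1/100.
  obtain ⟨ℓ, -, hℓ⟩ := exists_le_of_sum_le (s := (univ : Finset (Fin K)))
    (f := fun ℓ => 200 * K * #{p ∈ F ℓ | p ∈ B} + T) (g := fun ℓ => 2 * K * #(F ℓ))
    ⟨⟨0, hK⟩, mem_univ _⟩ (by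
      have e1 : ∑ ℓ, (200 * K * #{p ∈ F ℓ | p ∈ B} + T) = 200 * K * #B + K * T := by
        rw [sum_add_distrib, ← mul_sum, hBsum, sum_const, card_univ, Fintype.card_fin, smul_eq_mul]
      have e2 : ∑ ℓ, 2 * K * #(F ℓ) = 2 * K * T := by rw [← mul_sum, hFsum]
      rw [e1, e2]
      nlinarith)
  set 𝒳 : Finset X := {x | ∃ y, leaf x y = ℓ} with h𝒳
  set 𝒴 : Finset Y := {y | ∃ x, leaf x y = ℓ} with h𝒴
  have hrect : ∀ x ∈ 𝒳, ∀ y ∈ 𝒴, leaf x y = ℓ := by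
    intro x hx y hy
    simp only [h𝒳, h𝒴, mem_filter, mem_univ, true_and] at hx hy
    obtain ⟨y', hx⟩ := hx
    obtain ⟨x', hy⟩ := hy
    rw [hleaf x y' x' y (hx.trans hy.symm), hx]
  have hFeq : F ℓ = 𝒳 ×ˢ 𝒴 := by
    ext ⟨x, y⟩
    simp only [hF, mem_filter, mem_univ, true_and, mem_product]
    refine ⟨fun h => ⟨?_, ?_⟩, fun h => hrect x h.1 y h.2⟩
    · simp only [h𝒳, mem_filter, mem_univ, true_and]; exact ⟨y, h⟩
    · simp only [h𝒴, mem_filter, mem_univ, true_and]; exact ⟨x, h⟩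
  rw [hFeq, card_product] at hℓ
  refine ⟨ℓ, 𝒳, 𝒴, hrect, ?_, by omega⟩
  refine Nat.le_of_mul_le_mul_left ?_ (show 0 < 2 * K by omega)
  calc 2 * K * (100 * #{p ∈ 𝒳 ×ˢ 𝒴 | p ∈ B}) = 200 * K * #{p ∈ 𝒳 ×ˢ 𝒴 | p ∈ B} := by ring
    _ ≤ _ := by omega

variable {I J : Type*} [DecidableEq I] [DecidableEq J] [Fintype I] [Fintype J] {n : ℕ}

/-- The hard inputs: the rows of the first block depend only on `p.1` and those of the second block
only on `p.2`. -/
def hardMatrix (e : I ⊕ J ≃ Fin n) (s : ℝ) (p : Finset (I × J) × Finset (I × J)) :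
    Matrix (Fin n) (Fin n) ℝ :=
  Matrix.reindex e e (1 + signBlock s p)

lemma det_hardMatrix (e : I ⊕ J ≃ Fin n) (s : ℝ) (p : Finset (I × J) × Finset (I × J)) :
    (hardMatrix e s p).det = 1 - s ^ 2 * signInner p.1 p.2 + detRemainder s p := by
  rw [hardMatrix, Matrix.det_reindex_self, det_one_add_signBlock]

lemma IsTypical.det_hardMatrix_mem {s τ : ℝ} {p : Finset (I × J) × Finset (I × J)}
    (hp : IsTypical s τ p) (hτ : τ ≤ 1 / 4) (e : I ⊕ J ≃ Fin n) :
    1 / 2 ≤ (hardMatrix e s p).det ∧ (hardMatrix e s p).det ≤ 3 / 2 := by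
  rw [det_hardMatrix]
  have h1 := abs_le.1 hp.1
  have h2 := abs_le.1 hp.2.1
  constructor <;> linarith

lemma IsTypical.admissibleMatrix {s τ : ℝ} {p : Finset (I × J) × Finset (I × J)}
    (hp : IsTypical s τ p) (hτ : τ ≤ 1 / 4) (hs : 0 ≤ s) (hs1 : s ≤ 1) (e : I ⊕ J ≃ Fin n)
    (hn : 2 ≤ n) : AdmissibleMatrix (hardMatrix e s p) := by
  refine admissibleMatrix_of_det hn _ ?_ ?_ ?_
  · intro i j
    rw [hardMatrix, Matrix.reindex_apply, Matrix.submatrix_apply, Matrix.add_apply]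
    by_cases hij : e.symm i = e.symm j
    · rw [hij, (isSignSymmetric_signBlock hs).diag]; simp
    · rw [Matrix.one_apply_ne hij, zero_add]
      exact ((isSignSymmetric_signBlock hs).bound _ _ _).trans hs1
  · have := hp.det_hardMatrix_mem hτ e
    exact this.1.trans (le_abs_self _)
  · have h := hp.2.2
    have hcard : Fintype.card (I ⊕ J) = n := by simpa using Fintype.card_congr e
    rw [hcard] at h
    refine le_trans (le_of_eq ?_) h
    rw [hardMatrix, Matrix.adjugate_reindex, ← e.symm.sum_comp]
    refine sum_congr rfl fun i _ => ?_
    rw [← e.symm.sum_comp]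
    rfl

/-- The maximum norm is at most 1 exactly when each row passes its own test, and each row sees only
one half of the input. The other half is filled with the dummy `∅`. -/
lemma oracleAnswer_hardMatrix (e : I ⊕ J ≃ Fin n) (s : ℝ) :
    ∃ f g : Finset (I × J) → (Fin n → ℝ) → Bool, ∀ x y z,
      oracleAnswer (hardMatrix e s (x, y)) z = (f x z && g y z) := by
  classical
  refine ⟨fun x z => decide (∀ i : I, |(hardMatrix e s (x, ∅)).mulVec z (e (Sum.inl i))| ≤ 1),
    fun y z => decide (∀ j : J, |(hardMatrix e s (∅, y)).mulVec z (e (Sum.inr j))| ≤ 1),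
    fun x y z => ?_⟩
  have h1 : ∀ i : I, (hardMatrix e s (x, y)).mulVec z (e (Sum.inl i))
      = (hardMatrix e s (x, ∅)).mulVec z (e (Sum.inl i)) := by
    intro i
    simp only [Matrix.mulVec, dotProduct]
    refine sum_congr rfl fun k _ => congrArg (· * z k) ?_
    simp only [hardMatrix, Matrix.reindex_apply, Matrix.submatrix_apply, Matrix.add_apply,
      Equiv.symm_apply_apply]
    cases e.symm k <;> simp [signBlock]
  have h2 : ∀ j : J, (hardMatrix e s (x, y)).mulVec z (e (Sum.inr j))
      = (hardMatrix e s (∅, y)).mulVec z (e (Sum.inr j)) := by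
    intro i
    simp only [Matrix.mulVec, dotProduct]
    refine sum_congr rfl fun k _ => congrArg (· * z k) ?_
    simp only [hardMatrix, Matrix.reindex_apply, Matrix.submatrix_apply, Matrix.add_apply,
      Equiv.symm_apply_apply]
    cases e.symm k <;> simp [signBlock]
  rw [oracleAnswer, ← Bool.decide_and]
  refine decide_eq_decide.2 ?_
  rw [pi_norm_le_iff_of_nonneg zero_le_one, ← e.forall_congr_right, Sum.forall]
  simp only [Real.norm_eq_abs, h1, h2]

lemma abs_add_sub_le_of_mem {D V r τ : ℝ} (hτ : 0 ≤ τ) (hD : D ≤ 3 / 2) (hr : |r| ≤ τ)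
    (hlo : (1 - τ) * D ≤ V) (hhi : V ≤ (1 + τ) * D) : |r + (V - D)| ≤ 5 / 2 * τ := by
  have h1 := mul_le_mul_of_nonneg_left hD hτ
  have h2 := abs_le.1 hr
  rw [abs_le]
  constructor <;> linarith

/-- The dimension of the sign vectors is at most a multiple of the number of queries. -/
lemma card_lt_of_hardMatrix (e : I ⊕ J ≃ Fin n) (hn : 1600 ≤ n)
    (hN : 25 * (n : ℝ) ^ 2 ≤ 128 * Fintype.card (I × J))
    {Ω : Type*} [MeasurableSpace Ω] (μ : Measure Ω) [IsProbabilityMeasure μ]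
    (R : RandomizedAlgorithm n Ω) {q : ℕ}
    (hR : ∀ A : Matrix (Fin n) (Fin n) ℝ, AdmissibleMatrix A →
      1 - 1 / (n : ℝ) ≤ μ.real {ω | (R.alg ω).ApproximatesDet A (1 / 2 ^ 30)})
    (hq : ∀ A : Matrix (Fin n) (Fin n) ℝ, AdmissibleMatrix A →
      ∀ᵐ ω ∂μ, (R.alg ω).MakesAtMost A q) :
    Fintype.card (I × J) < 64 * q + 96 := by
  classical
  by_contra! hlarge
  have hn0 : (1600 : ℝ) ≤ n := by exact_mod_cast hn
  have hcard : Fintype.card (I ⊕ J) = n := by simpa using Fintype.card_congr e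
  -- With `τ = β / 64` the remainder term in Chebyshev is `2 * β ^ 3 / τ ^ 2 = 2 ^ 13 * β = 2 ^
  -- (-11)`, while `τ` stays a constant fraction of `β`.
  set β : ℝ := 1 / 2 ^ 24 with hβ
  set τ : ℝ := 1 / 2 ^ 30 with hτ
  set s : ℝ := √(β / n) with hs
  have hs0 : 0 ≤ s := Real.sqrt_nonneg _
  have hs2 : s ^ 2 = β / n := Real.sq_sqrt (by positivity)
  have hns : n * s ^ 2 = β := by rw [hs2]; field_simp
  have hs2pos : 0 < s ^ 2 := by rw [hs2]; positivity
  have hs1 : s ≤ 1 := by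
    refine le_of_sq_le_sq ?_ zero_le_one
    have : β ≤ 1 := by rw [hβ]; norm_num
    nlinarith
  have hτ4 : τ ≤ 1 / 4 := by rw [hτ]; norm_num
  set P := Finset (I × J) × Finset (I × J)
  -- Correctness is promised on admissible inputs only, so averaging runs over typical pairs;
  -- atypical ones join the exceptional set as `B₁`.
  set ι := {p : P // IsTypical s τ p}
  have hadm : ∀ p : ι, AdmissibleMatrix (hardMatrix e s p.1) := fun p =>
    p.2.admissibleMatrix hτ4 hs0 hs1 e (by omega)
  obtain ⟨ω, hω, hfail⟩ := R.exists_seed μ (fun p : ι => hardMatrix e s p.1)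
    (fun p => hR _ (hadm p)) (fun p => hq _ (hadm p))
  set a := R.alg ω
  set B₁ : Finset P := {p | ¬ IsTypical s τ p}
  set B₂ : Finset P := ({p : ι | ¬ a.ApproximatesDet (hardMatrix e s p.1) τ} : Finset ι).image
    Subtype.val with hB₂
  have hB : 200 * #(B₁ ∪ B₂)
      ≤ Fintype.card (Finset (I × J)) * Fintype.card (Finset (I × J)) := by
    have h1 : (#B₁ : ℝ) ≤ Fintype.card P * (32 * β ^ 2 + 2 * β ^ 3 / τ ^ 2 + 3 / n) := by
      have := card_not_isTypical_le (I := I) (J := J) (s := s) (β := β) (τ := τ) hs0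
        (by rw [hcard]; exact hns) (by rw [hβ]; norm_num) (by rw [hτ]; norm_num)
        (by rw [hcard]; omega)
      rw [hcard] at this
      exact this
    have h2 : (#B₂ : ℝ) ≤ Fintype.card P * (1 / n) := by
      refine le_trans (Nat.cast_le.2 card_image_le) (hfail.trans ?_)
      gcongr
      exact Fintype.card_subtype_le _
    have h3 : (#(B₁ ∪ B₂) : ℝ) ≤ #B₁ + #B₂ := by exact_mod_cast card_union_le _ _
    have h4 : 32 * β ^ 2 + 2 * β ^ 3 / τ ^ 2 + 3 / n + 1 / n ≤ 1 / 200 := by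
      have h5 : (3 : ℝ) / n + 1 / n ≤ 1 / 400 := by
        rw [← add_div, div_le_div_iff₀ (by linarith) (by norm_num)]; linarith
      have h6 : 32 * β ^ 2 + 2 * β ^ 3 / τ ^ 2 ≤ 1 / 400 := by rw [hβ, hτ]; norm_num
      linarith
    have h7 : (#(B₁ ∪ B₂) : ℝ) ≤ Fintype.card P * (1 / 200) := by
      have := mul_le_mul_of_nonneg_left h4 (Nat.cast_nonneg (α := ℝ) (Fintype.card P))
      linarith
    have h8 : (200 * #(B₁ ∪ B₂) : ℝ) ≤ Fintype.card P := by linarith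
    rw [← Fintype.card_prod]
    exact_mod_cast h8
  obtain ⟨f, g, hfg⟩ := oracleAnswer_hardMatrix (I := I) (J := J) e s
  obtain ⟨leaf, hleaf, hrun⟩ := DetAlgorithm.exists_rectangle_partition
    (fun x y => hardMatrix e s (x, y)) f g hfg a q []
  obtain ⟨ℓ, 𝒳, 𝒴, hℓ, hbad, hsize⟩ := exists_good_rectangle (by positivity) leaf hleaf _ hB
  rw [Fintype.card_finset] at hsize
  have h4q : 2 * 4 ^ q = 2 ^ (2 * q + 1) := by
    rw [pow_succ, pow_mul]; norm_num; ring
  rw [h4q] at hsize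
  have hcard_le : ∀ 𝒵 : Finset (Finset (I × J)), #𝒵 ≤ 2 ^ Fintype.card (I × J) := fun 𝒵 => by
    rw [← Fintype.card_finset]; exact card_le_univ 𝒵
  have hpos : 0 < 2 ^ Fintype.card (I × J) := by positivity
  have h𝒳 : 2 ^ Fintype.card (I × J) ≤ 2 ^ (2 * q + 1) * #𝒳 := by
    refine Nat.le_of_mul_le_mul_right ?_ hpos
    calc _ ≤ _ := hsize
      _ = 2 ^ (2 * q + 1) * #𝒳 * #𝒴 := by ring
      _ ≤ _ := Nat.mul_le_mul_left _ (hcard_le 𝒴)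
  have h𝒴 : 2 ^ Fintype.card (I × J) ≤ 2 ^ (2 * q + 1) * #𝒴 := by
    refine Nat.le_of_mul_le_mul_right ?_ hpos
    calc _ ≤ _ := hsize
      _ = 2 ^ (2 * q + 1) * #𝒴 * #𝒳 := by ring
      _ ≤ _ := Nat.mul_le_mul_left _ (hcard_le 𝒳)
  obtain ⟨x₀, hx₀⟩ : 𝒳.Nonempty := by
    rw [nonempty_iff_ne_empty]; rintro rfl; simp at h𝒳
  obtain ⟨y₀, hy₀⟩ : 𝒴.Nonempty := by
    rw [nonempty_iff_ne_empty]; rintro rfl; simp at h𝒴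
  -- The common output on the rectangle. The default 0 is never used in the end: the run agrees with
  -- that of a typical, correctly treated pair, which does stop.
  set V := (a.runFrom (hardMatrix e s (x₀, y₀)) q []).getD 0 with hV
  -- `W` is chosen so that `s ^ 2 * W = 5 / 2 * τ`, the total error: `τ` from the remainder and `3 /
  -- 2 * τ` from the output.
  obtain ⟨x, hx, y, hy, hxy, hfar⟩ := signInner_dispersion h𝒳 h𝒴 (by omega) (B₁ ∪ B₂) hbad
    (V := (1 - V) / s ^ 2) (W := 5 / 128 * n) (by nlinarith)
  simp only [mem_union, not_or] at hxy
  obtain ⟨hxy1, hxy2⟩ := hxy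
  have htyp : IsTypical s τ (x, y) := by
    by_contra h; exact hxy1 (mem_filter.2 ⟨mem_univ _, h⟩)
  have happ : a.ApproximatesDet (hardMatrix e s (x, y)) τ := by
    by_contra h
    refine hxy2 (mem_image.2 ⟨⟨(x, y), htyp⟩, ?_, rfl⟩)
    exact mem_filter.2 ⟨mem_univ _, h⟩
  obtain ⟨V', hV', hlo, hhi⟩ := happ.exists_outputsWithin (hω ⟨(x, y), htyp⟩)
  have hVV : V' = V := by
    have h := hrun x₀ y₀ x y ((hℓ _ hx₀ _ hy₀).trans (hℓ _ hx _ hy).symm)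
    rw [hV, h, show a.runFrom (hardMatrix e s (x, y)) q [] = some V' from hV']
    rfl
  rw [hVV] at hlo hhi
  obtain ⟨hd1, hd2⟩ := htyp.det_hardMatrix_mem hτ4 e
  rw [abs_of_pos (by linarith)] at hlo hhi
  have hdet := det_hardMatrix e s (x, y)
  have hτ0 : 0 < τ := by rw [hτ]; norm_num
  have hclose : |s ^ 2 * signInner x y - (1 - V)| ≤ 5 / 2 * τ := by
    have e1 : s ^ 2 * signInner x y - (1 - V)
        = detRemainder s (x, y) + (V - (hardMatrix e s (x, y)).det) := by
      rw [hdet]; ring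
    rw [e1]
    exact abs_add_sub_le_of_mem hτ0.le hd2 htyp.2.1 hlo hhi
  have hfar' : 5 / 2 * τ < |s ^ 2 * signInner x y - (1 - V)| := by
    have e1 : s ^ 2 * signInner x y - (1 - V) = s ^ 2 * (signInner x y - (1 - V) / s ^ 2) := by
      rw [mul_sub, mul_div_cancel₀ _ hs2pos.ne']
    have e2 : 5 / 2 * τ = s ^ 2 * (5 / 128 * n) := by
      rw [show s ^ 2 * (5 / 128 * (n : ℝ)) = 5 / 128 * (n * s ^ 2) by ring, hns, hτ, hβ]
      norm_num
    rw [e1, abs_mul, abs_of_pos hs2pos, e2]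
    exact mul_lt_mul_of_pos_left hfar hs2pos
  linarith

/-- Three diagonal matrices with different determinants show that at least one query is needed. -/
lemma one_le_of_approximatesDet (hn : 2 ≤ n)
    {Ω : Type*} [MeasurableSpace Ω] (μ : Measure Ω) [IsProbabilityMeasure μ]
    (R : RandomizedAlgorithm n Ω) {q : ℕ}
    (hR : ∀ A : Matrix (Fin n) (Fin n) ℝ, AdmissibleMatrix A →
      1 - 1 / (n : ℝ) ≤ μ.real {ω | (R.alg ω).ApproximatesDet A (1 / 2 ^ 30)})
    (hq : ∀ A : Matrix (Fin n) (Fin n) ℝ, AdmissibleMatrix A →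
      ∀ᵐ ω ∂μ, (R.alg ω).MakesAtMost A q) : 1 ≤ q := by
  classical
  by_contra! hq0
  obtain rfl : q = 0 := by omega
  have hn2 : (2 : ℝ) ≤ n := by exact_mod_cast hn
  -- Three inputs are needed: at `n = 2` the error rate 1/2 permits one failure, and two correct
  -- answers must remain to contradict each other.
  set d : Fin 3 → ℝ := ![1, 3 / 4, 1 / 2] with hd
  have hd1 : ∀ k, 1 / 2 ≤ d k ∧ d k ≤ 1 := by
    intro k; fin_cases k <;> simp [hd] <;> norm_num
  set v : Fin 3 → Fin n → ℝ := fun k => Function.update 1 ⟨0, by omega⟩ (d k) with hv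
  have hv1 : ∀ k i, 0 ≤ v k i ∧ v k i ≤ 1 := by
    intro k i
    simp only [hv, Function.update_apply, Pi.one_apply]
    have := hd1 k
    split_ifs <;> constructor <;> linarith
  have hdet : ∀ k, (Matrix.diagonal (v k)).det = d k := by
    intro k
    rw [Matrix.det_diagonal, hv, prod_update_of_mem (mem_univ _)]
    simp
  have hadm : ∀ k, AdmissibleMatrix (Matrix.diagonal (v k)) := by
    intro k
    refine admissibleMatrix_of_det hn _ ?_ ?_ ?_
    · intro i j
      rw [Matrix.diagonal_apply]
      split_ifs
      · rw [abs_le]; have := hv1 k i; constructor <;> linarith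
      · simp
    · rw [hdet]; exact (hd1 k).1.trans (le_abs_self _)
    · rw [Matrix.adjugate_diagonal]
      calc ∑ i, ∑ j, (Matrix.diagonal fun i => ∏ j ∈ univ.erase i, v k j) i j ^ 2
          ≤ ∑ i : Fin n, ∑ j : Fin n, (1 : ℝ) := by
            refine sum_le_sum fun i _ => sum_le_sum fun j _ => ?_
            rw [Matrix.diagonal_apply]
            split_ifs
            · exact pow_le_one₀ (prod_nonneg fun j _ => (hv1 k j).1)
                (prod_le_one (fun j _ => (hv1 k j).1) fun j _ => (hv1 k j).2)
            · simp
        _ = (n : ℝ) ^ 2 := by simp; ring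
        _ ≤ ((n : ℝ) ^ 2) ^ 2 := le_self_pow₀ (by nlinarith) (by norm_num)
  obtain ⟨ω, hω, hfail⟩ := R.exists_seed μ (fun k => Matrix.diagonal (v k))
    (fun k => hR _ (hadm k)) (fun k => hq _ (hadm k))
  set S : Finset (Fin 3) := {k | (R.alg ω).ApproximatesDet (Matrix.diagonal (v k)) (1 / 2 ^ 30)}
    with hS
  have hcard : 1 < #S := by
    have h1 : #S + #{k : Fin 3 | ¬ (R.alg ω).ApproximatesDet (Matrix.diagonal (v k)) (1 / 2 ^ 30)}
        = 3 := by
      rw [hS]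
      convert! card_filter_add_card_filter_not (s := (univ : Finset (Fin 3)))
        (fun k => (R.alg ω).ApproximatesDet (Matrix.diagonal (v k)) (1 / 2 ^ 30))
    have h2 : (1 : ℝ) / n ≤ 1 / 2 := one_div_le_one_div_of_le (by norm_num) hn2
    have h3 : (#{k : Fin 3 | ¬ (R.alg ω).ApproximatesDet (Matrix.diagonal (v k)) (1 / 2 ^ 30)} : ℝ)
        < 2 := by
      refine lt_of_le_of_lt hfail ?_
      simp only [Fintype.card_fin]
      push_cast
      linarith
    have h4 : #{k : Fin 3 | ¬ (R.alg ω).ApproximatesDet (Matrix.diagonal (v k)) (1 / 2 ^ 30)} < 2 := by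
      exact_mod_cast h3
    omega
  obtain ⟨k, hk, l, hl, hkl⟩ := one_lt_card.1 hcard
  obtain ⟨V, hV, hV1, hV2⟩ := (mem_filter.1 hk).2.exists_outputsWithin (hω k)
  obtain ⟨V', hV', hV1', hV2'⟩ := (mem_filter.1 hl).2.exists_outputsWithin (hω l)
  have hVV : V = V' := by
    unfold DetAlgorithm.OutputsWithin at hV hV'
    rw [DetAlgorithm.runFrom_zero] at hV hV'
    exact Option.some_inj.1 (hV.symm.trans hV')
  subst hVV
  have e1 := hd1 k
  have e2 := hd1 l
  rw [hdet, abs_of_pos (by linarith)] at hV1 hV2 hV1' hV2'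
  fin_cases k <;> fin_cases l <;> simp [hd] at hkl hV1 hV2 hV1' hV2' <;> norm_num at * <;> linarith

end LowerBound

/-! ### Assembly -/

theorem theorem3 :
    ∃ c : ℝ, 0 < c ∧ ∃ C : ℝ, 0 < C ∧
      ∀ n : ℕ, 2 ≤ n →
      ∀ (Ω : Type*) [MeasurableSpace Ω] (μ : Measure Ω) [IsProbabilityMeasure μ]
        (R : RandomizedAlgorithm n Ω),
        -- on every admissible input the output is correct with probability at least `1 - 1/n`
        (∀ A : Matrix (Fin n) (Fin n) ℝ, AdmissibleMatrix A →
          1 - 1 / (n : ℝ) ≤ μ.real {ω | (R.alg ω).ApproximatesDet A c}) →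
        -- any bound `q` on the number of queries is at least `C n² / log n`
        ∀ q : ℕ,
          (∀ A : Matrix (Fin n) (Fin n) ℝ, AdmissibleMatrix A →
            ∀ᵐ ω ∂μ, (R.alg ω).MakesAtMost A q) →
          C * (n : ℝ) ^ 2 / Real.log n ≤ (q : ℝ) := by
  have hlog2 : 0 < Real.log 2 := Real.log_pos (by norm_num)
  refine ⟨1 / 2 ^ 30, by positivity, Real.log 2 / 1600 ^ 2, by positivity, ?_⟩
  intro n hn Ω _ μ _ R hR q hq
  have hn2 : (2 : ℝ) ≤ n := by exact_mod_cast hn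
  have hlog : Real.log 2 ≤ Real.log n := Real.log_le_log (by norm_num) hn2
  have key : (n : ℝ) ^ 2 / 1600 ^ 2 ≤ q := by
    -- Below 1600 the claimed bound is at most 1 and one query suffices. Above, the matrix is split
    -- into nearly equal halves, so that `N` is about `n ^ 2 / 4`.
    rcases lt_or_ge n 1600 with hsmall | hlarge
    · have h1 : (1 : ℝ) ≤ q := by exact_mod_cast one_le_of_approximatesDet hn μ R hR hq
      have h2 : (n : ℝ) ≤ 1600 := by exact_mod_cast hsmall.le
      refine le_trans ?_ h1
      rw [div_le_one (by positivity)]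
      gcongr
    · have hsum : n / 2 + (n - n / 2) = n := by omega
      have hprod : n ^ 2 ≤ 4 * (n / 2 * (n - n / 2)) + 1 := by
        rcases Nat.even_or_odd' n with ⟨k, rfl | rfl⟩
        · have h1 : 2 * k / 2 = k := by omega
          have h2 : 2 * k - k = k := by omega
          rw [h1, h2]; exact (by ring : (2 * k) ^ 2 = 4 * (k * k)).le.trans (Nat.le_succ _)
        · have h1 : (2 * k + 1) / 2 = k := by omega
          have h2 : 2 * k + 1 - k = k + 1 := by omega
          rw [h1, h2]; exact (by ring : (2 * k + 1) ^ 2 = 4 * (k * (k + 1)) + 1).le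
      have hprod' : (n : ℝ) ^ 2 ≤ 4 * ((n / 2 * (n - n / 2) : ℕ) : ℝ) + 1 := by
        exact_mod_cast hprod
      have hn0 : (1600 : ℝ) ≤ n := by exact_mod_cast hlarge
      have h := card_lt_of_hardMatrix (finSumFinEquiv.trans (finCongr hsum)) hlarge
        (by
          rw [Fintype.card_prod, Fintype.card_fin, Fintype.card_fin]
          nlinarith) μ R hR hq
      rw [Fintype.card_prod, Fintype.card_fin, Fintype.card_fin] at h
      have h' : ((n / 2 * (n - n / 2) : ℕ) : ℝ) < 64 * q + 96 := by exact_mod_cast h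
      rw [div_le_iff₀ (by positivity)]
      nlinarith
  refine le_trans ?_ key
  rw [div_le_iff₀ (by linarith)]
  have h3 : (0 : ℝ) ≤ (n : ℝ) ^ 2 / 1600 ^ 2 := by positivity
  calc Real.log 2 / 1600 ^ 2 * (n : ℝ) ^ 2 = (n : ℝ) ^ 2 / 1600 ^ 2 * Real.log 2 := by ring
    _ ≤ _ := mul_le_mul_of_nonneg_left hlog h3
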